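/- For a real number $b\ge 1$ and $\mathrm{Re}\,z>0$ let $f_b(z)=\sum_{k=0}^{\infty}e^{-zk^{b}}$, and for $d>0$, $s\in\mathbb{R}$ let $$Q_{b,d}(s)=\lim_{x\to 0^+}x^{1/d}f_b(x+2\pi i s)$$ whenever this limit exists. For $m,n,b\in\mathbb{N}$, $n\ge 1$, put $L_b(m,n)=\frac1n\sum_{l=1}^{n}e^{-2\pi i\frac mn l^{b}}$. (i) Let $b\ge 1$ be an integer. There is $M<\infty$ such that, for all sufficiently small $x>0$ and all $y\in\mathbb{R}$, $x^{1/b}|f_b(x+iy)|<M$. If $m,n\in\mathbb{N}$, $n\ge1$, are relatively prime, then $Q_{b,b}(m/n)$ exists and $$\frac{Q_{b,b}(m/n)}{\Gamma(1+1/b)}=L_b(m,n),$$ while $Q_{b,b}(s)$ exists and equals $0$ for almost every $s\in\mathbb{R}$. (ii) Let $b=3/2$. As $z\to0$ along the positive reals, $z^{2/3}f_{3/2}(z)\to\Gamma(5/3)$. For every real $y\ne0$, $f_{3/2}(x+iy)=O(x^{-1/2})$ as $x\to0^+$. If $m,n\ge1$ are relatively prime integers and $s=\frac{4}{27}\frac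 nm$, then $Q_{3/2,2}(\sqrt s)$ exists and $$Q_{3/2,2}(\sqrt s)=\sqrt{\frac{\pi}{3i}}\;s^{1/4}\,L_3(m,n),$$ while $Q_{3/2,2}(\sqrt s)$ exists and equals $0$ for almost every $s>0$. Moreover, for every real $s\ne0$, $Q_{3/2,2}(s)$ exists if and only if $Q_{3,3}\!\left(\frac{4}{27s^{2}}\right)$ exists, and in that case $$Q_{3/2,2}(s)=\frac{1}{\Gamma(4/3)}\sqrt{\frac{\pi s}{3i}}\;Q_{3,3}\!\left(\frac{4}{27s^{2}}\right).$$ Square roots are principal branches. -/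

import Mathlib

open Filter Topology MeasureTheory Asymptotics

/-- The Dirichlet series `f(z) = ∑_{k ≥ 0} exp (-z g(k))`. -/
noncomputable def dirichletSeries (g : ℕ → ℝ) (z : ℂ) : ℂ :=
  ∑' k : ℕ, Complex.exp (-z * (g k : ℂ))

/-- The function `f` attached to `g(k) = k ^ b`. -/
noncomputable def powerDirichlet (b : ℝ) (z : ℂ) : ℂ :=
  dirichletSeries (fun k => (k : ℝ) ^ b) z

/-- The series defining `powerDirichlet` converges absolutely in the right half plane. -/
theorem powerDirichlet_summable (b : ℝ) (hb : 1 ≤ b) (z : ℂ) (hz : 0 < z.re) :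
    Summable (fun k : ℕ => ‖Complex.exp (-z * (((k : ℝ) ^ b : ℝ) : ℂ))‖) := by
  have hgeo : Summable (fun k : ℕ => Real.exp (-z.re) ^ k) :=
    summable_geometric_of_lt_one (Real.exp_pos _).le (by simpa using hz)
  refine Summable.of_nonneg_of_le (fun k => norm_nonneg _) (fun k => ?_) hgeo
  rw [Complex.norm_exp, Complex.re_mul_ofReal, ← Real.exp_nat_mul]
  apply Real.exp_le_exp.mpr
  have hk : (k : ℝ) ≤ (k : ℝ) ^ b := by
    rcases Nat.eq_zero_or_pos k with h | h
    · subst h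
      simpa using Real.rpow_nonneg (le_refl (0 : ℝ)) b
    · have h1 : (1 : ℝ) ≤ (k : ℝ) := by exact_mod_cast h
      simpa using Real.rpow_le_rpow_of_exponent_le h1 hb
  simp only [Complex.neg_re]
  nlinarith

/-- `HasProfile b d s L` : the limit defining the rescaled boundary profile
`Q_{b,d}(s) = lim_{x → 0⁺} x ^ (1 / d) * f(x + 2 π i s)`, for `g(k) = k ^ b`, exists and
equals `L`. -/
def HasProfile (b d s : ℝ) (L : ℂ) : Prop :=
  Tendsto
    (fun x : ℝ => ((x ^ (1 / d) : ℝ) : ℂ) *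
      powerDirichlet b ((x : ℂ) + 2 * (Real.pi : ℂ) * Complex.I * (s : ℂ)))
    (𝓝[>] 0) (𝓝 L)

/-- The normalized exponential sum `(1 / n) ∑_{l = 1}^{n} exp (-2 π i (m / n) l ^ b)`. -/
noncomputable def expMean (b m n : ℕ) : ℂ :=
  (1 / (n : ℂ)) * ∑ l ∈ Finset.Icc 1 n,
    Complex.exp (-2 * (Real.pi : ℂ) * Complex.I * ((m : ℂ) / (n : ℂ)) * (l : ℂ) ^ b)

/-! Each term of `f_b(x + 2πis)` is a unit phase times `exp(-x k^b)`. An Abelian theorem,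
`tendsto_tsum_mul_exp_neg`, therefore turns the asymptotics `C N^α` of the partial sums of the
phases into the limit `C Γ(1 + α/b)` of `x^(α/b) f_b`. What remains is the study of exponential
sums.

For integer `b` and rational `s` the phases are periodic in `k`, and their mean is the average over
a period. For irrational `s`, hence for almost every `s`, Weyl's theorem gives mean zero; its proof
lowers the degree by van der Corput differencing.

For `b = 3/2` and `s > 0` the phase `s k^(3/2) - j k` is stationary at `√k = 2j/(3s)`. It is a cubic
polynomial in `√k`, so its expansion there is exact: the value is `-4j³/(27s²)`, the quadratic
coefficient is `j`, and the cubic term is negligible. The indices with `√k` within `κ/√j` of that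
point contribute `√j exp(2πi·4j³/(27s²))` times a truncated Fresnel integral
(`norm_sum_window_sub_le`). Between two windows the Kusmin–Landau inequality gives only `O(√j/κ)`
(`norm_sum_gap_le`). Summing over `j`, with `κ` arbitrarily large, replaces the sum over `k` by a
`√j`-weighted sum of `exp(2πi t j³)` with `t = 4/(27s²)`, that is, of the phases for `b = 3`. This
yields growth of order `N^(3/4)` and the duality.

The cubic means exist for every real `t` and are real, because `j ↦ -j` conjugates the terms. Hence
both profiles in the duality always exist, and only their values have to be compared; negative `s`
follows by conjugation. -/

/-! ### The additive character -/

/-- The additive character `x ↦ exp (2 π i x)`. -/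
noncomputable def unitExp (x : ℝ) : ℂ := Complex.exp (2 * Real.pi * Complex.I * x)

theorem unitExp_eq_exp_mul_I (x : ℝ) :
    unitExp x = Complex.exp (((2 * Real.pi * x : ℝ) : ℂ) * Complex.I) := by
  unfold unitExp; congr 1; push_cast; ring

theorem unitExp_add (x y : ℝ) : unitExp (x + y) = unitExp x * unitExp y := by
  unfold unitExp; rw [← Complex.exp_add]; congr 1; push_cast; ring

@[simp] theorem unitExp_zero : unitExp 0 = 1 := by simp [unitExp]

@[simp] theorem norm_unitExp (x : ℝ) : ‖unitExp x‖ = 1 := by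
  rw [unitExp_eq_exp_mul_I, Complex.norm_exp_ofReal_mul_I]

theorem unitExp_neg (x : ℝ) : unitExp (-x) = starRingEnd ℂ (unitExp x) := by
  unfold unitExp
  rw [← Complex.exp_conj]
  congr 1
  simp [map_ofNat]

theorem unitExp_sub (x y : ℝ) : unitExp (x - y) = unitExp x * starRingEnd ℂ (unitExp y) := by
  rw [sub_eq_add_neg, unitExp_add, unitExp_neg]

@[simp] theorem unitExp_intCast (n : ℤ) : unitExp n = 1 := by
  unfold unitExp
  rw [Complex.exp_eq_one_iff]
  exact ⟨n, by push_cast; ring⟩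

@[simp] theorem unitExp_natCast (n : ℕ) : unitExp n = 1 := by
  simpa using unitExp_intCast (n : ℤ)

theorem unitExp_natCast_mul (n : ℕ) (x : ℝ) : unitExp (n * x) = unitExp x ^ n := by
  unfold unitExp
  rw [← Complex.exp_nat_mul]; congr 1; push_cast; ring

theorem unitExp_eq_one_iff (x : ℝ) : unitExp x = 1 ↔ ∃ n : ℤ, x = n := by
  unfold unitExp
  rw [Complex.exp_eq_one_iff]
  have hpi : (2 * (Real.pi : ℂ) * Complex.I) ≠ 0 := Complex.two_pi_I_ne_zero
  constructor
  · rintro ⟨n, hn⟩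
    refine ⟨n, ?_⟩
    have : (x : ℂ) = n := mul_left_cancel₀ hpi (by rw [hn]; ring)
    exact_mod_cast this
  · rintro ⟨n, rfl⟩
    exact ⟨n, by push_cast; ring⟩

theorem continuous_unitExp : Continuous unitExp := by
  unfold unitExp; fun_prop

theorem norm_unitExp_sub_le (x y : ℝ) :
    ‖unitExp x - unitExp y‖ ≤ 2 * Real.pi * |x - y| := by
  have h : unitExp x - unitExp y = unitExp y * (unitExp (x - y) - 1) := by
    rw [mul_sub, ← unitExp_add]; simp
  rw [h, norm_mul, norm_unitExp, one_mul, unitExp_eq_exp_mul_I, mul_comm _ Complex.I]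
  refine (Real.norm_exp_I_mul_ofReal_sub_one_le).trans ?_
  rw [Real.norm_eq_abs, abs_mul, abs_of_pos Real.two_pi_pos]

/-! ### Cesàro means and van der Corput's difference theorem -/

/-- The averages of the sequence `a` converge to `c`. -/
def HasMean (a : ℕ → ℂ) (c : ℂ) : Prop :=
  Tendsto (fun N : ℕ => (∑ k ∈ Finset.range N, a k) / (N : ℂ)) atTop (𝓝 c)

namespace HasMean

variable {a b : ℕ → ℂ} {c d : ℂ}

theorem add (ha : HasMean a c) (hb : HasMean b d) : HasMean (fun k => a k + b k) (c + d) := by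
  refine (Tendsto.add ha hb).congr fun N => ?_
  rw [Finset.sum_add_distrib, add_div]

theorem sum {ι : Type*} (s : Finset ι) {a : ι → ℕ → ℂ} {c : ι → ℂ}
    (h : ∀ i ∈ s, HasMean (a i) (c i)) :
    HasMean (fun k => ∑ i ∈ s, a i k) (∑ i ∈ s, c i) := by
  refine (tendsto_finsetSum s h).congr fun N => ?_
  rw [Finset.sum_comm, Finset.sum_div]

theorem conj (ha : HasMean a c) :
    HasMean (fun k => starRingEnd ℂ (a k)) (starRingEnd ℂ c) := by
  refine ((Complex.continuous_conj.tendsto c).comp ha).congr fun N => ?_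
  simp

theorem const (c : ℂ) : HasMean (fun _ => c) c := by
  refine tendsto_const_nhds.congr' ?_
  filter_upwards [eventually_ge_atTop 1] with N hN
  have : (N : ℂ) ≠ 0 := by exact_mod_cast (by omega : N ≠ 0)
  simp [this]

theorem zero_of_bounded {C : ℝ} (h : ∀ N, ‖∑ k ∈ Finset.range N, a k‖ ≤ C) : HasMean a 0 := by
  refine squeeze_zero_norm (a := fun N : ℕ => C / N) (fun N => ?_)
    (tendsto_const_div_atTop_nhds_zero_nat C)
  rw [norm_div, Complex.norm_natCast]
  exact div_le_div_of_nonneg_right (h N) N.cast_nonneg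

theorem shift {C : ℝ} (hC : ∀ k, ‖a k‖ ≤ C) (ha : HasMean a c) (m : ℕ) :
    HasMean (fun k => a (k + m)) c := by
  have h0 : HasMean (fun k => a (k + m) - a k) 0 := by
    refine zero_of_bounded (C := m * C + m * C) fun N => ?_
    have h1 : ∑ k ∈ Finset.range N, (a (k + m) - a k)
        = (∑ k ∈ Finset.range m, a (N + k)) - ∑ k ∈ Finset.range m, a k := by
      have e1 := Finset.sum_range_add a m N
      have e2 := Finset.sum_range_add a N m
      rw [add_comm N m, e1] at e2
      rw [Finset.sum_sub_distrib, sub_eq_sub_iff_add_eq_add]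
      simp only [add_comm _ m]
      rw [add_comm, e2, add_comm]
    rw [h1]
    have hb : ∀ M, ‖∑ k ∈ Finset.range m, a (M + k)‖ ≤ m * C := fun M => by
      refine (norm_sum_le _ _).trans ((Finset.sum_le_sum fun k _ => hC (M + k)).trans ?_)
      simp
    refine (norm_sub_le _ _).trans (add_le_add (hb N) ?_)
    simpa using hb 0
  simpa using ha.add h0

/-- After subtraction of the average, the sum over a full period vanishes, so the partial sums are
themselves periodic and hence bounded. -/
theorem of_periodic {n : ℕ} (hn : 0 < n) (h : Function.Periodic a n) :
    HasMean a ((∑ k ∈ Finset.range n, a k) / n) := by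
  set c := (∑ k ∈ Finset.range n, a k) / (n : ℂ) with hc
  have hn' : (n : ℂ) ≠ 0 := by exact_mod_cast hn.ne'
  let S : ℕ → ℂ := fun N => ∑ k ∈ Finset.range N, (a k - c)
  have hper : Function.Periodic S n := by
    intro N
    have h0 : ∑ k ∈ Finset.range n, (a k - c) = 0 := by
      simp only [Finset.sum_sub_distrib, Finset.sum_const, Finset.card_range, nsmul_eq_mul, hc]
      field_simp
      ring
    change ∑ k ∈ Finset.range (N + n), (a k - c) = ∑ k ∈ Finset.range N, (a k - c)
    rw [add_comm N n, Finset.sum_range_add, h0, zero_add]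
    refine Finset.sum_congr rfl fun k _ => ?_
    rw [add_comm n k, h k]
  have hS : HasMean (fun k => a k - c) 0 := by
    refine zero_of_bounded (C := ∑ r ∈ Finset.range n, ‖S r‖) fun N => ?_
    change ‖S N‖ ≤ _
    rw [← hper.map_mod_nat N]
    exact Finset.single_le_sum (f := fun r => ‖S r‖) (fun _ _ => norm_nonneg _)
      (Finset.mem_range.mpr (Nat.mod_lt N hn))
  simpa using hS.add (const c)

/-- Van der Corput's difference theorem. -/
theorem zero_of_correlation {u : ℕ → ℂ} (hu : ∀ n, ‖u n‖ = 1)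
    (hc : ∀ h : ℕ, 1 ≤ h → HasMean (fun n => u (n + h) * starRingEnd ℂ (u n)) 0) :
    HasMean u 0 := by
  -- The shifts of `u` are asymptotically orthonormal: a pair of shifts is a translate of a single
  -- correlation, up to conjugation.
  have hpair : ∀ h h' : ℕ, HasMean (fun n => u (n + h) * starRingEnd ℂ (u (n + h')))
      (if h = h' then 1 else 0) := by
    have hlt : ∀ h h' : ℕ, h' < h →
        HasMean (fun n => u (n + h) * starRingEnd ℂ (u (n + h'))) 0 := by
      intro h h' hh
      have h1 := (hc (h - h') (by omega)).shift (C := 1) (fun k => by simp [hu]) h'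
      refine h1.congr fun N => ?_
      congr 1
      refine Finset.sum_congr rfl fun k _ => ?_
      beta_reduce
      rw [show k + h' + (h - h') = k + h by omega]
    intro h h'
    rcases lt_trichotomy h h' with hh | rfl | hh
    · rw [if_neg hh.ne]
      have h1 := (hlt h' h hh).conj
      rw [map_zero] at h1
      refine h1.congr fun N => ?_
      congr 1
      refine Finset.sum_congr rfl fun k _ => ?_
      simp [mul_comm]
    · rw [if_pos rfl]
      refine (const 1).congr fun N => ?_
      congr 1
      refine Finset.sum_congr rfl fun k _ => ?_
      beta_reduce
      rw [Complex.mul_conj, Complex.normSq_eq_norm_sq, hu]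
      simp
    · rw [if_neg hh.ne']
      exact hlt h h' hh
  -- Expanding the square leaves only the diagonal, so block sums of length `H` have mean square `H`
  -- instead of the trivial `H²`.
  have hsq : ∀ H : ℕ, Tendsto (fun N : ℕ =>
      (∑ n ∈ Finset.range N, ‖∑ h ∈ Finset.range H, u (n + h)‖ ^ 2) / (N : ℝ)) atTop (𝓝 (H : ℝ)) := by
    intro H
    have h1 := HasMean.sum (Finset.range H) (fun h _ =>
      HasMean.sum (Finset.range H) (fun h' _ => hpair h h'))
    have h2 : (∑ i ∈ Finset.range H, ∑ j ∈ Finset.range H, (if i = j then (1 : ℂ) else 0)) = H := by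
      rw [Finset.sum_congr rfl (g := fun _ => (1 : ℂ))]
      · simp
      · intro i hi
        simp [Finset.mem_range.mp hi]
    rw [h2] at h1
    have h3 := (Complex.continuous_re.tendsto _).comp h1
    simp only [Complex.natCast_re] at h3
    refine h3.congr fun N => ?_
    have h4 : (∑ n ∈ Finset.range N, ∑ i ∈ Finset.range H, ∑ j ∈ Finset.range H,
        u (n + i) * starRingEnd ℂ (u (n + j))) / (N : ℂ)
        = (((∑ n ∈ Finset.range N, ‖∑ h ∈ Finset.range H, u (n + h)‖ ^ 2) / (N : ℝ) : ℝ) : ℂ) := by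
      push_cast
      congr 1
      refine Finset.sum_congr rfl fun n _ => ?_
      rw [← Finset.sum_mul_sum, ← map_sum, Complex.mul_conj, Complex.normSq_eq_norm_sq]
      push_cast; rfl
    rw [Function.comp_apply, h4, Complex.ofReal_re]
  -- Averaging over `H` shifts costs only boundary terms, at most `2H` per shift; Cauchy–Schwarz
  -- then brings in the mean square of the block sums.
  have key : ∀ H : ℕ, 1 ≤ H → ∀ N : ℕ, 1 ≤ N → ‖(∑ k ∈ Finset.range N, u k) / (N : ℂ)‖ ≤
      √((∑ n ∈ Finset.range N, ‖∑ h ∈ Finset.range H, u (n + h)‖ ^ 2) / (N : ℝ)) / H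
        + (2 * H : ℝ) / N := by
    intro H hH N hN
    set D := ∑ n ∈ Finset.range N, ‖∑ h ∈ Finset.range H, u (n + h)‖ ^ 2 with hD
    have hH' : (0 : ℝ) < H := by exact_mod_cast hH
    have hN' : (0 : ℝ) < N := by exact_mod_cast hN
    have hD0 : 0 ≤ D := Finset.sum_nonneg fun _ _ => by positivity
    have hcs : ‖∑ n ∈ Finset.range N, ∑ h ∈ Finset.range H, u (n + h)‖ ≤ N * √(D / N) := by
      refine (norm_sum_le _ _).trans ?_
      have := sq_sum_le_card_mul_sum_sq (s := Finset.range N)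
        (f := fun n => ‖∑ h ∈ Finset.range H, u (n + h)‖)
      rw [Finset.card_range, ← hD] at this
      refine abs_le_of_sq_le_sq' (a := ∑ n ∈ Finset.range N, ‖∑ h ∈ Finset.range H, u (n + h)‖)
        ?_ (by positivity) |>.2
      rw [mul_pow, Real.sq_sqrt (by positivity)]
      refine this.trans (le_of_eq ?_)
      field_simp
    have hdiff : ‖(∑ n ∈ Finset.range N, ∑ h ∈ Finset.range H, u (n + h))
        - H * ∑ n ∈ Finset.range N, u n‖ ≤ 2 * H * H := by
      have e : (∑ n ∈ Finset.range N, ∑ h ∈ Finset.range H, u (n + h))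
          - H * ∑ n ∈ Finset.range N, u n
          = ∑ h ∈ Finset.range H, ((∑ k ∈ Finset.range h, u (N + k)) - ∑ k ∈ Finset.range h, u k) := by
        rw [Finset.sum_comm]
        have : (H : ℂ) * ∑ n ∈ Finset.range N, u n
            = ∑ h ∈ Finset.range H, ∑ n ∈ Finset.range N, u n := by simp
        rw [this, ← Finset.sum_sub_distrib]
        refine Finset.sum_congr rfl fun h _ => ?_
        have e1 := Finset.sum_range_add u h N
        have e2 := Finset.sum_range_add u N h
        rw [add_comm N h, e1] at e2
        rw [sub_eq_sub_iff_add_eq_add]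
        simp only [add_comm _ h]
        rw [add_comm, e2, add_comm]
      rw [e]
      refine (norm_sum_le _ _).trans ?_
      have hb : ∀ h ∈ Finset.range H,
          ‖(∑ k ∈ Finset.range h, u (N + k)) - ∑ k ∈ Finset.range h, u k‖ ≤ 2 * H := by
        intro h hh
        have hhH : (h : ℝ) ≤ H := by exact_mod_cast (Finset.mem_range.mp hh).le
        have hs : ∀ M, ‖∑ k ∈ Finset.range h, u (M + k)‖ ≤ h := fun M => by
          refine (norm_sum_le _ _).trans ?_
          simp [hu]
        refine (norm_sub_le _ _).trans ?_
        have h1 := hs N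
        have h2 := hs 0
        simp only [zero_add] at h2
        linarith
      refine (Finset.sum_le_sum hb).trans (le_of_eq ?_)
      simp; ring
    have hfin : (H : ℝ) * ‖∑ k ∈ Finset.range N, u k‖ ≤ N * √(D / N) + 2 * H * H := by
      have h1 : ‖(H : ℂ) * ∑ n ∈ Finset.range N, u n‖ = H * ‖∑ k ∈ Finset.range N, u k‖ := by
        rw [norm_mul, Complex.norm_natCast]
      rw [← h1]
      have h2 := norm_sub_norm_le ((H : ℂ) * ∑ n ∈ Finset.range N, u n)
        (∑ n ∈ Finset.range N, ∑ h ∈ Finset.range H, u (n + h))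
      rw [norm_sub_rev] at h2
      linarith
    rw [norm_div, Complex.norm_natCast, div_le_iff₀ hN']
    rw [← mul_le_mul_iff_right₀ hH']
    refine hfin.trans (le_of_eq ?_)
    field_simp
  rw [HasMean, tendsto_zero_iff_norm_tendsto_zero, Metric.tendsto_atTop]
  intro ε hε
  -- With `H > 1/ε²` the limiting bound `√H / H = 1/√H` is below `ε`.
  obtain ⟨H, hH⟩ := exists_nat_gt ((1 / ε) ^ 2)
  have hH0 : (0 : ℝ) < H := lt_of_le_of_lt (by positivity) hH
  have hH1 : 1 ≤ H := by exact_mod_cast hH0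
  have hlim : Tendsto (fun N : ℕ =>
      √((∑ n ∈ Finset.range N, ‖∑ h ∈ Finset.range H, u (n + h)‖ ^ 2) / (N : ℝ)) / H
        + (2 * H : ℝ) / N) atTop (𝓝 (√H / H + 0)) :=
    (((Real.continuous_sqrt.tendsto _).comp (hsq H)).div_const _).add
      (tendsto_const_div_atTop_nhds_zero_nat _)
  have hlt : √H / H + 0 < ε := by
    rw [add_zero, Real.sqrt_div_self', div_lt_iff₀ (Real.sqrt_pos.mpr hH0)]
    have h5 : 1 / ε < √H := Real.lt_sqrt_of_sq_lt hH
    rw [div_lt_iff₀ hε] at h5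
    linarith
  obtain ⟨N₀, hN₀⟩ := eventually_atTop.mp (hlim.eventually (gt_mem_nhds hlt))
  refine ⟨max N₀ 1, fun N hN => ?_⟩
  rw [Real.dist_eq, sub_zero, abs_of_nonneg (norm_nonneg _)]
  exact (key H hH1 N (le_trans (le_max_right _ _) hN)).trans_lt
    (hN₀ N (le_trans (le_max_left _ _) hN))

end HasMean

/-! ### Weyl's theorem for polynomial phases -/

/-- Weyl's theorem: polynomial sequences with irrational leading coefficient have mean zero. -/
theorem hasMean_unitExp_polynomial (d : ℕ) (p : Polynomial ℝ) (hd : p.natDegree ≤ d + 1)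
    (hp : Irrational (p.coeff (d + 1))) : HasMean (fun n => unitExp (p.eval (n : ℝ))) 0 := by
  induction d generalizing p with
  | zero =>
    have hev : ∀ n : ℕ, unitExp (p.eval (n : ℝ))
        = unitExp (p.coeff 0) * unitExp (p.coeff 1) ^ n := by
      intro n
      rw [Polynomial.eq_X_add_C_of_natDegree_le_one hd]
      simp only [Polynomial.eval_add, Polynomial.eval_mul, Polynomial.eval_C, Polynomial.eval_X]
      rw [add_comm, unitExp_add, mul_comm (p.coeff 1), unitExp_natCast_mul]
      simp
    have hne : unitExp (p.coeff 1) ≠ 1 := by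
      rw [Ne, unitExp_eq_one_iff]
      rintro ⟨n, hn⟩
      exact hp ⟨n, by simpa using hn.symm⟩
    -- In degree one the sum is geometric, with ratio different from 1 because the slope is not an
    -- integer.
    refine HasMean.zero_of_bounded (C := 2 / ‖unitExp (p.coeff 1) - 1‖) fun N => ?_
    simp only [hev]
    rw [← Finset.mul_sum, geom_sum_eq hne, norm_mul, norm_unitExp, one_mul, norm_div]
    refine div_le_div_of_nonneg_right ?_ (norm_nonneg _)
    refine (norm_sub_le _ _).trans ?_
    rw [norm_pow, norm_unitExp, norm_one]; norm_num
  | succ d ih =>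
    refine HasMean.zero_of_correlation (fun n => norm_unitExp _) fun h hh => ?_
    -- The correlation with shift `h` has phase `p(X + h) - p(X)`. Its degree drops by one, and its
    -- top coefficient is that of `p` times the positive integer `(d + 2) h`, hence still
    -- irrational.
    set q := Polynomial.taylor (h : ℝ) p - p with hq
    have hcoef : ∀ k, q.coeff k = (Polynomial.hasseDeriv k p).eval (h : ℝ) - p.coeff k := by
      intro k; rw [hq, Polynomial.coeff_sub, Polynomial.taylor_coeff]
    have hlin : ∀ k, d + 1 ≤ k → (Polynomial.hasseDeriv k p).eval (h : ℝ)
        = p.coeff k + (k + 1) * p.coeff (k + 1) * h := by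
      intro k hk
      have hdeg : (Polynomial.hasseDeriv k p).natDegree ≤ 1 :=
        (Polynomial.natDegree_hasseDeriv_le p k).trans (by omega)
      rw [Polynomial.eq_X_add_C_of_natDegree_le_one hdeg]
      simp only [Polynomial.eval_add, Polynomial.eval_mul, Polynomial.eval_C, Polynomial.eval_X,
        Polynomial.hasseDeriv_coeff]
      rw [zero_add, Nat.choose_self, add_comm 1 k, Nat.choose_succ_self_right]
      push_cast; ring
    have hqd : q.natDegree ≤ d + 1 := by
      rw [Polynomial.natDegree_le_iff_coeff_eq_zero]
      intro k hk
      rw [hcoef, hlin k hk.le, Polynomial.coeff_eq_zero_of_natDegree_lt (n := k + 1) (by omega)]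
      ring
    have hqc : Irrational (q.coeff (d + 1)) := by
      have e : q.coeff (d + 1) = p.coeff (d + 1 + 1) * (((d + 1 + 1) * h : ℕ) : ℝ) := by
        rw [hcoef, hlin _ le_rfl]; push_cast; ring
      rw [e]
      exact hp.mul_natCast (by positivity)
    refine (ih q hqd hqc).congr fun N => ?_
    congr 1
    refine Finset.sum_congr rfl fun n _ => ?_
    beta_reduce
    rw [← unitExp_sub, hq, Polynomial.eval_sub, Polynomial.taylor_eval]
    push_cast; rfl

/-- For irrational `α` the sequence `exp (2 π i α n ^ b)` has mean zero. -/
theorem hasMean_unitExp_pow {α : ℝ} (hα : Irrational α) {b : ℕ} (hb : 1 ≤ b) :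
    HasMean (fun n => unitExp (α * (n : ℝ) ^ b)) 0 := by
  obtain ⟨d, rfl⟩ : ∃ d, b = d + 1 := ⟨b - 1, by omega⟩
  have := hasMean_unitExp_polynomial d (Polynomial.C α * Polynomial.X ^ (d + 1))
    (Polynomial.natDegree_C_mul_X_pow_le _ _) (by simpa using hα)
  simpa using this

/-! ### The Abelian theorem and its consequences for profiles -/

/-- A generalized Dirichlet series with frequencies `k ^ b` as a Laplace integral of the summatory
function of its coefficients. -/
theorem tsum_mul_exp_neg_eq_integral {a : ℕ → ℂ} (ha : ∀ k, ‖a k‖ ≤ 1) {b : ℝ} (hb : 1 ≤ b)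
    {x : ℝ} (hx : 0 < x) :
    ∑' k : ℕ, a k * (Real.exp (-(x * (k : ℝ) ^ b)) : ℂ)
      = ∫ u in Set.Ioi (0 : ℝ),
          (∑ k ∈ Finset.range ⌈(u / x) ^ (1 / b)⌉₊, a k) * (Real.exp (-u) : ℂ) := by
  have hb0 : 0 < b := by linarith
  have hc : ∀ k : ℕ, 0 ≤ x * (k : ℝ) ^ b := fun k => by positivity
  -- `exp(-x k^b)` is the integral of `exp(-u)` over `u > x k^b`. After sum and integral are
  -- exchanged, the indices alive at `u` are those with `k < (u/x)^(1/b)`.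
  let F : ℕ → ℝ → ℂ := fun k => (Set.Ioi (x * (k : ℝ) ^ b)).indicator
    (fun u => a k * (Real.exp (-u) : ℂ))
  have hexp : ∀ c : ℝ, IntegrableOn (fun u : ℝ => Real.exp (-u)) (Set.Ioi c) := fun c =>
    integrableOn_exp_neg_Ioi c
  have hint : ∀ k, IntegrableOn (fun u : ℝ => a k * (Real.exp (-u) : ℂ))
      (Set.Ioi (x * (k : ℝ) ^ b)) := fun k => ((hexp _).ofReal).const_mul (a k)
  have hFint : ∀ k, Integrable (F k) (volume.restrict (Set.Ioi 0)) := fun k =>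
    ((integrable_indicator_iff measurableSet_Ioi).mpr (hint k)).restrict
  have hinter : ∀ k : ℕ, Set.Ioi (x * (k : ℝ) ^ b) ∩ Set.Ioi 0 = Set.Ioi (x * (k : ℝ) ^ b) :=
    fun k => Set.inter_eq_left.mpr (Set.Ioi_subset_Ioi (hc k))
  have hFval : ∀ k, ∫ u in Set.Ioi (0 : ℝ), F k u = a k * (Real.exp (-(x * (k : ℝ) ^ b)) : ℂ) := by
    intro k
    rw [integral_indicator measurableSet_Ioi, Measure.restrict_restrict measurableSet_Ioi, hinter,
      integral_const_mul, integral_complex_ofReal, integral_exp_neg_Ioi]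
  have hFnorm : ∀ k, ∫ u in Set.Ioi (0 : ℝ), ‖F k u‖
      = ‖a k‖ * Real.exp (-(x * (k : ℝ) ^ b)) := by
    intro k
    simp only [F, norm_indicator_eq_indicator_norm]
    rw [integral_indicator measurableSet_Ioi, Measure.restrict_restrict measurableSet_Ioi, hinter]
    simp only [norm_mul, Complex.norm_real, Real.norm_eq_abs, Real.abs_exp]
    rw [integral_const_mul, integral_exp_neg_Ioi]
  have hsum : Summable fun k => ∫ u in Set.Ioi (0 : ℝ), ‖F k u‖ := by
    have h1 := powerDirichlet_summable b hb (x : ℂ) (by simpa using hx)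
    refine Summable.of_nonneg_of_le (fun k => integral_nonneg fun _ => norm_nonneg _)
      (fun k => ?_) h1
    rw [hFnorm, Complex.norm_exp]
    have : (-(x : ℂ) * (((k : ℝ) ^ b : ℝ) : ℂ)).re = -(x * (k : ℝ) ^ b) := by
      rw [← Complex.ofReal_neg, ← Complex.ofReal_mul, Complex.ofReal_re]; ring
    rw [this]
    exact mul_le_of_le_one_left (Real.exp_pos _).le (ha k)
  have h2 := integral_tsum_of_summable_integral_norm hFint hsum
  simp only [hFval] at h2
  rw [h2]
  refine setIntegral_congr_fun measurableSet_Ioi fun u hu => ?_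
  have hu0 : (0 : ℝ) < u := hu
  have hmem : ∀ k : ℕ, u ∈ Set.Ioi (x * (k : ℝ) ^ b) ↔ k < ⌈(u / x) ^ (1 / b)⌉₊ := by
    intro k
    rw [Nat.lt_ceil, Set.mem_Ioi, one_div,
      Real.lt_rpow_inv_iff_of_pos (Nat.cast_nonneg k) (by positivity) hb0, lt_div_iff₀ hx, mul_comm]
  rw [tsum_eq_sum (s := Finset.range ⌈(u / x) ^ (1 / b)⌉₊), Finset.sum_mul]
  · refine Finset.sum_congr rfl fun k hk => ?_
    exact Set.indicator_of_mem ((hmem k).mpr (Finset.mem_range.mp hk)) _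
  · intro k hk
    exact Set.indicator_of_notMem (fun h => hk (Finset.mem_range.mpr ((hmem k).mp h))) _

/-- Abelian theorem: if the partial sums of `a` are asymptotic to `C * N ^ α`, then
`∑ a k * exp (-x * k ^ b)` is asymptotic to `C * Γ(1 + α / b) * x ^ (-α / b)` as `x → 0⁺`. -/
theorem tendsto_tsum_mul_exp_neg {a : ℕ → ℂ} (ha : ∀ k, ‖a k‖ ≤ 1) {b α : ℝ} (hb : 1 ≤ b)
    (hα : 0 < α) (hα1 : α ≤ 1) {C : ℂ}
    (h : Tendsto (fun N : ℕ => (∑ k ∈ Finset.range N, a k) / (((N : ℝ) ^ α : ℝ) : ℂ)) atTop (𝓝 C)) :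
    Tendsto (fun x : ℝ => ((x ^ (α / b) : ℝ) : ℂ) *
      ∑' k : ℕ, a k * (Real.exp (-(x * (k : ℝ) ^ b)) : ℂ)) (𝓝[>] 0)
      (𝓝 (C * Real.Gamma (1 + α / b))) := by
  have hb0 : 0 < b := by linarith
  have hb1 : 0 < 1 / b := by positivity
  set A : ℕ → ℂ := fun N => ∑ k ∈ Finset.range N, a k with hA
  obtain ⟨M, hM0, hM⟩ : ∃ M : ℝ, 0 ≤ M ∧ ∀ N : ℕ, ‖A N‖ ≤ M * (N : ℝ) ^ α := by
    obtain ⟨M, hM⟩ := (Metric.isBounded_range_of_tendsto _ h).exists_norm_le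
    have hM' : ∀ N : ℕ, ‖A N / (((N : ℝ) ^ α : ℝ) : ℂ)‖ ≤ M := fun N => hM _ ⟨N, rfl⟩
    refine ⟨M, (norm_nonneg _).trans (hM' 0), fun N => ?_⟩
    rcases Nat.eq_zero_or_pos N with rfl | hN
    · simp [hA, Real.zero_rpow hα.ne']
    · have hp : 0 < (N : ℝ) ^ α := Real.rpow_pos_of_pos (by exact_mod_cast hN) _
      have := hM' N
      rwa [norm_div, Complex.norm_real, Real.norm_eq_abs, abs_of_pos hp, div_le_iff₀ hp] at this
  have hxpow : ∀ x : ℝ, 0 < x → x ^ (α / b) = (x ^ (1 / b)) ^ α := by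
    intro x hx
    rw [← Real.rpow_mul hx.le]; congr 1; ring
  have hmain : Tendsto (fun x : ℝ => ∫ u in Set.Ioi (0 : ℝ),
      ((x ^ (α / b) : ℝ) : ℂ) * (A ⌈(u / x) ^ (1 / b)⌉₊ * (Real.exp (-u) : ℂ))) (𝓝[>] 0)
      (𝓝 (∫ u in Set.Ioi (0 : ℝ), C * ((Real.exp (-u) * u ^ ((1 + α / b) - 1) : ℝ) : ℂ))) := by
    -- The majorant is `M (u + 2) exp(-u)`, split into integrands of `Γ(2)` and `Γ(1)`; the shift 2
    -- absorbs the ceiling and `u^(1/b) ≤ u + 1`.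
    refine tendsto_integral_filter_of_dominated_convergence
      (fun u => M * (Real.exp (-u) * u ^ ((2 : ℝ) - 1) + 2 * (Real.exp (-u) * u ^ ((1 : ℝ) - 1))))
      ?_ ?_ ?_ ?_
    · refine Eventually.of_forall fun x => Measurable.aestronglyMeasurable ?_
      have h1 : Measurable fun u : ℝ => A ⌈(u / x) ^ (1 / b)⌉₊ :=
        (measurable_of_countable A).comp (Nat.measurable_ceil.comp (by fun_prop))
      fun_prop
    · filter_upwards [self_mem_nhdsWithin, Ioc_mem_nhdsGT (zero_lt_one' ℝ)] with x hx hx1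
      refine (ae_restrict_iff' measurableSet_Ioi).mpr (Eventually.of_forall fun u hu => ?_)
      have hx0 : (0 : ℝ) < x := hx
      have hu0 : (0 : ℝ) < u := hu
      rw [norm_mul, norm_mul, Complex.norm_real, Complex.norm_real, Real.norm_eq_abs,
        Real.norm_eq_abs, Real.abs_exp, abs_of_nonneg (by positivity), hxpow x hx0]
      have e1 : Real.exp (-u) * u ^ ((2 : ℝ) - 1) + 2 * (Real.exp (-u) * u ^ ((1 : ℝ) - 1))
          = (u + 2) * Real.exp (-u) := by
        norm_num; ring
      rw [e1, ← mul_assoc, ← mul_assoc]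
      refine mul_le_mul_of_nonneg_right ?_ (Real.exp_pos _).le
      set v := (u / x) ^ (1 / b) with hv
      have hv0 : 0 ≤ v := by positivity
      have hxb0 : 0 ≤ x ^ (1 / b) := by positivity
      have hxb1 : x ^ (1 / b) ≤ 1 := Real.rpow_le_one hx0.le hx1.2 hb1.le
      have hxv : x ^ (1 / b) * v = u ^ (1 / b) := by
        rw [hv, ← Real.mul_rpow hx0.le (by positivity)]; congr 1; field_simp
      have hub : u ^ (1 / b) ≤ u + 1 := by
        rcases le_total u 1 with h1 | h1
        · have := Real.rpow_le_one hu0.le h1 hb1.le; linarith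
        · have := Real.rpow_le_rpow_of_exponent_le h1 (show 1 / b ≤ 1 by
            rw [div_le_one hb0]; exact hb)
          rw [Real.rpow_one] at this; linarith
      have hceil : (⌈v⌉₊ : ℝ) ≤ v + 1 := (Nat.ceil_lt_add_one hv0).le
      calc (x ^ (1 / b)) ^ α * ‖A ⌈v⌉₊‖
          ≤ (x ^ (1 / b)) ^ α * (M * (⌈v⌉₊ : ℝ) ^ α) :=
            mul_le_mul_of_nonneg_left (hM _) (by positivity)
        _ = M * (x ^ (1 / b) * (⌈v⌉₊ : ℝ)) ^ α := by
            rw [Real.mul_rpow hxb0 (Nat.cast_nonneg _)]; ring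
        _ ≤ M * (u + 2) ^ α := by
            refine mul_le_mul_of_nonneg_left (Real.rpow_le_rpow (by positivity) ?_ hα.le) hM0
            calc x ^ (1 / b) * (⌈v⌉₊ : ℝ) ≤ x ^ (1 / b) * (v + 1) :=
                  mul_le_mul_of_nonneg_left hceil hxb0
              _ ≤ u + 2 := by rw [mul_add, hxv]; linarith
        _ ≤ M * (u + 2) := by
            refine mul_le_mul_of_nonneg_left ?_ hM0
            have := Real.rpow_le_rpow_of_exponent_le (show 1 ≤ u + 2 by linarith) hα1
            rwa [Real.rpow_one] at this
    · exact ((Real.GammaIntegral_convergent two_pos).add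
        ((Real.GammaIntegral_convergent one_pos).const_mul 2)).const_mul M
    · refine (ae_restrict_iff' measurableSet_Ioi).mpr (Eventually.of_forall fun u hu => ?_)
      have hu0 : (0 : ℝ) < u := hu
      -- Pointwise limit: with `N = ⌈(u/x)^(1/b)⌉`, the quotient `A N / N^α` tends to `C`, while `N
      -- x^(1/b)` tends to `u^(1/b)`.
      have hY : Tendsto (fun x : ℝ => (x⁻¹) ^ (1 / b)) (𝓝[>] 0) atTop :=
        (tendsto_rpow_atTop hb1).comp tendsto_inv_nhdsGT_zero
      have hub : 0 < u ^ (1 / b) := Real.rpow_pos_of_pos hu0 _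
      have hN : Tendsto (fun x : ℝ => ⌈u ^ (1 / b) * (x⁻¹) ^ (1 / b)⌉₊) (𝓝[>] 0) atTop :=
        tendsto_nat_ceil_atTop.comp (hY.const_mul_atTop hub)
      have h1 := h.comp hN
      have h2 := ((tendsto_nat_ceil_mul_div_atTop hub.le).comp hY).rpow_const (p := α)
        (Or.inr hα.le)
      have h3 := (h1.mul ((Complex.continuous_ofReal.tendsto _).comp h2)).mul_const
        (Real.exp (-u) : ℂ)
      have e : C * (((u ^ (1 / b)) ^ α : ℝ) : ℂ) * (Real.exp (-u) : ℂ)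
          = C * ((Real.exp (-u) * u ^ ((1 + α / b) - 1) : ℝ) : ℂ) := by
        rw [← hxpow u hu0, add_sub_cancel_left]; push_cast; ring
      rw [e] at h3
      refine h3.congr' ?_
      filter_upwards [self_mem_nhdsWithin] with x hx
      have hx0 : (0 : ℝ) < x := hx
      simp only [Function.comp_apply]
      have e2 : u ^ (1 / b) * (x⁻¹) ^ (1 / b) = (u / x) ^ (1 / b) := by
        rw [← Real.mul_rpow hu0.le (by positivity), div_eq_mul_inv u x]
      rw [e2]
      set N := ⌈(u / x) ^ (1 / b)⌉₊ with hN'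
      have hNpos : 0 < N := Nat.ceil_pos.mpr (by positivity)
      have hNα : (((N : ℝ) ^ α : ℝ) : ℂ) ≠ 0 :=
        Complex.ofReal_ne_zero.mpr (Real.rpow_pos_of_pos (by exact_mod_cast hNpos) _).ne'
      have e3 : ((N : ℝ) / (x⁻¹) ^ (1 / b)) ^ α = (N : ℝ) ^ α * x ^ (α / b) := by
        rw [hxpow x hx0, Real.inv_rpow hx0.le, div_inv_eq_mul,
          Real.mul_rpow (Nat.cast_nonneg _) (by positivity)]
      rw [e3]
      push_cast at hNα ⊢
      field_simp
      rw [mul_comm]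
  have hR : (∫ u in Set.Ioi (0 : ℝ), C * ((Real.exp (-u) * u ^ ((1 + α / b) - 1) : ℝ) : ℂ))
      = C * Real.Gamma (1 + α / b) := by
    rw [integral_const_mul, integral_complex_ofReal, Real.Gamma_eq_integral (by positivity)]
  rw [hR] at hmain
  refine hmain.congr' ?_
  filter_upwards [self_mem_nhdsWithin] with x hx
  rw [tsum_mul_exp_neg_eq_integral ha hb hx, integral_const_mul]

theorem powerDirichlet_eq_tsum (b x s : ℝ) :
    powerDirichlet b ((x : ℂ) + 2 * (Real.pi : ℂ) * Complex.I * (s : ℂ))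
      = ∑' k : ℕ, unitExp (-(s * (k : ℝ) ^ b)) * (Real.exp (-(x * (k : ℝ) ^ b)) : ℂ) := by
  unfold powerDirichlet dirichletSeries
  refine tsum_congr fun k => ?_
  rw [unitExp, Complex.ofReal_exp, ← Complex.exp_add]
  congr 1
  push_cast
  ring

/-- Asymptotics of the exponential sums `∑_{k < N} exp (-2 π i s k ^ b)` yield the profile. -/
theorem hasProfile_of_tendsto {b d s α : ℝ} (hb : 1 ≤ b) (hα : 0 < α) (hα1 : α ≤ 1)
    (hd : 1 / d = α / b) {C : ℂ}
    (h : Tendsto (fun N : ℕ => (∑ k ∈ Finset.range N, unitExp (-(s * (k : ℝ) ^ b))) /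
      (((N : ℝ) ^ α : ℝ) : ℂ)) atTop (𝓝 C)) :
    HasProfile b d s (C * Real.Gamma (1 + 1 / d)) := by
  have := tendsto_tsum_mul_exp_neg (fun k => (norm_unitExp _).le) hb hα hα1 h
  unfold HasProfile
  simp only [powerDirichlet_eq_tsum, hd]
  exact this

theorem hasProfile_of_hasMean {b s : ℝ} (hb : 1 ≤ b) {c : ℂ}
    (h : HasMean (fun k => unitExp (-(s * (k : ℝ) ^ b))) c) :
    HasProfile b b s (c * Real.Gamma (1 + 1 / b)) := by
  refine hasProfile_of_tendsto hb one_pos le_rfl rfl (h.congr fun N => ?_)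
  simp

/-- The modulus of each term does not depend on `y`, and on the real axis all terms are positive. -/
theorem norm_powerDirichlet_le {b : ℝ} (hb : 1 ≤ b) {x : ℝ} (hx : 0 < x) (y : ℝ) :
    ‖powerDirichlet b ((x : ℂ) + Complex.I * (y : ℂ))‖ ≤ ‖powerDirichlet b (x : ℂ)‖ := by
  have hs := powerDirichlet_summable b hb ((x : ℂ) + Complex.I * (y : ℂ)) (by simpa using hx)
  have hterm : ∀ k : ℕ, ‖Complex.exp (-((x : ℂ) + Complex.I * (y : ℂ)) * (((k : ℝ) ^ b : ℝ) : ℂ))‖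
      = Real.exp (-(x * (k : ℝ) ^ b)) := by
    intro k
    rw [Complex.norm_exp, Complex.re_mul_ofReal]
    simp
  have hx' : powerDirichlet b (x : ℂ) = ((∑' k : ℕ, Real.exp (-(x * (k : ℝ) ^ b)) : ℝ) : ℂ) := by
    unfold powerDirichlet dirichletSeries
    rw [Complex.ofReal_tsum]
    refine tsum_congr fun k => ?_
    push_cast; congr 1; ring
  rw [hx', Complex.norm_real, Real.norm_eq_abs, abs_of_nonneg (tsum_nonneg fun _ => (Real.exp_pos _).le)]
  refine (norm_tsum_le_tsum_norm hs).trans (le_of_eq ?_)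
  exact tsum_congr hterm

theorem powerDirichlet_conj (b : ℝ) (z : ℂ) :
    powerDirichlet b (starRingEnd ℂ z) = starRingEnd ℂ (powerDirichlet b z) := by
  unfold powerDirichlet dirichletSeries
  rw [Complex.conj_tsum]
  refine tsum_congr fun k => ?_
  rw [← Complex.exp_conj, map_mul, map_neg, Complex.conj_ofReal]

theorem HasProfile.neg {b d s : ℝ} {L : ℂ} (h : HasProfile b d s L) :
    HasProfile b d (-s) (starRingEnd ℂ L) := by
  refine ((Complex.continuous_conj.tendsto L).comp h).congr fun x => ?_
  rw [Function.comp_apply, map_mul, Complex.conj_ofReal, ← powerDirichlet_conj]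
  congr 2
  simp [map_ofNat]

/-! ### The Kusmin–Landau inequality -/

/-- Jordan's inequality `sin t ≥ 2t/π` on `[0, π/2]`, reflected about `d = 1/2`. It bounds from
below the denominators in the Kusmin–Landau argument. -/
theorem two_mul_le_sin_pi_mul {δ d : ℝ} (hδ : 0 < δ) (h1 : δ ≤ d) (h2 : d ≤ 1 - δ) :
    2 * δ ≤ Real.sin (Real.pi * d) := by
  have hpi := Real.pi_pos
  have key : ∀ e : ℝ, δ ≤ e → e ≤ 1 / 2 → 2 * δ ≤ Real.sin (Real.pi * e) := by
    intro e h1 h2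
    have h3 := Real.mul_le_sin (x := Real.pi * e) (by nlinarith) (by nlinarith)
    have h4 : 2 / Real.pi * (Real.pi * e) = 2 * e := by field_simp
    linarith
  rcases le_total d (1 / 2) with h | h
  · exact key d h1 h
  · have := key (1 - d) (by linarith) (by linarith)
    rwa [show Real.pi * (1 - d) = Real.pi - Real.pi * d by ring, Real.sin_pi_sub] at this

/-- The Kusmin–Landau inequality. -/
theorem norm_sum_range_unitExp_le {g : ℕ → ℝ} {δ : ℝ} (hδ : 0 < δ) (n : ℕ)
    (hmono : ∀ k, k + 1 < n → g (k + 1) - g k ≤ g (k + 2) - g (k + 1))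
    (hlo : ∀ k < n, δ ≤ g (k + 1) - g k) (hhi : ∀ k < n, g (k + 1) - g k ≤ 1 - δ) :
    ‖∑ k ∈ Finset.range n, unitExp (g k)‖ ≤ 1 / δ := by
  set θ : ℕ → ℝ := fun k => Real.pi * (g (k + 1) - g k) with hθ
  set C : ℕ → ℝ := fun k => Real.cos (θ k) / Real.sin (θ k) with hC
  -- This is `1 / (1 - e(Δ))` for the increment `Δ` of `g`, written as `(1 + i cot πΔ)/2`. Each term
  -- of the sum thereby becomes `c k` times a difference of consecutive terms, ready for summation
  -- by parts.
  set c : ℕ → ℂ := fun k => (1 + Complex.I * C k) / 2 with hc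
  have hsin : ∀ k < n, 2 * δ ≤ Real.sin (θ k) := fun k hk =>
    two_mul_le_sin_pi_mul hδ (hlo k hk) (hhi k hk)
  have hcid : ∀ k < n, c k * (1 - unitExp (g (k + 1) - g k)) = 1 := by
    intro k hk
    have hs : Real.sin (θ k) ≠ 0 := by have := hsin k hk; linarith
    have h1 : unitExp (g (k + 1) - g k)
        = (Complex.cos (θ k) + Complex.sin (θ k) * Complex.I) ^ 2 := by
      rw [← Complex.exp_mul_I, ← Complex.exp_nat_mul, unitExp]
      congr 1
      simp only [hθ]; push_cast; ring
    have hs' : Complex.sin (θ k) ≠ 0 := by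
      rw [← Complex.ofReal_sin]; exact Complex.ofReal_ne_zero.mpr hs
    have h2 := Complex.sin_sq_add_cos_sq (θ k)
    simp only [hc, hC]
    rw [h1]
    push_cast
    field_simp
    have hI := Complex.I_sq
    linear_combination (-Complex.cos (θ k) * Complex.sin (θ k) ^ 2 * Complex.I
      - Complex.sin (θ k) ^ 3 - 2 * Complex.sin (θ k) * Complex.cos (θ k) ^ 2) * hI
      + (Complex.sin (θ k) - Complex.I * Complex.cos (θ k)) * h2
  have hstep : ∀ k < n, unitExp (g k) = unitExp (g k) * c k - unitExp (g (k + 1)) * c k := by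
    intro k hk
    have h1 : unitExp (g (k + 1)) = unitExp (g k) * unitExp (g (k + 1) - g k) := by
      rw [← unitExp_add]; congr 1; ring
    rw [h1]
    linear_combination (-unitExp (g k)) * hcid k hk
  have hCabs : ∀ k < n, |C k| ≤ 1 / (2 * δ) := by
    intro k hk
    have h1 := hsin k hk
    rw [hC, abs_div, abs_of_pos (show 0 < Real.sin (θ k) by linarith)]
    exact div_le_div₀ zero_le_one (Real.abs_cos_le_one _) (by linarith) h1
  have hcn : ∀ k < n, ‖c k‖ ≤ 1 / (4 * δ) := by
    intro k hk
    have h1 := hsin k hk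
    have hs : Real.sin (θ k) ≠ 0 := by linarith
    have h2 : c k = Complex.I * (Complex.exp ((-θ k : ℝ) * Complex.I)) /
        (2 * (Real.sin (θ k) : ℂ)) := by
      have hs' : Complex.sin (θ k) ≠ 0 := by
        rw [← Complex.ofReal_sin]; exact Complex.ofReal_ne_zero.mpr hs
      simp only [hc, hC]
      rw [Complex.exp_mul_I]
      push_cast
      rw [Complex.cos_neg, Complex.sin_neg]
      field_simp
      linear_combination (Complex.sin (θ k)) * Complex.I_sq
    rw [h2, norm_div, norm_mul, Complex.norm_I, Complex.norm_exp_ofReal_mul_I, norm_mul,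
      Complex.norm_real, Real.norm_eq_abs, abs_of_pos (by linarith)]
    simp only [Complex.norm_ofNat, mul_one]
    exact div_le_div₀ zero_le_one le_rfl (by linarith) (by linarith)
  have hCmono : ∀ k, k + 1 < n → C (k + 1) ≤ C k := by
    intro k hk
    have h1 := hsin k (by omega)
    have h2 := hsin (k + 1) hk
    have h3 : 0 ≤ Real.sin (θ (k + 1) - θ k) := by
      refine Real.sin_nonneg_of_nonneg_of_le_pi ?_ ?_
      · have := hmono k hk
        have hp := Real.pi_pos
        simp only [hθ]
        nlinarith
      · have e1 := hhi (k + 1) hk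
        have e2 := hlo k (by omega)
        have hp := Real.pi_pos
        simp only [hθ]
        have : (g (k + 1 + 1) - g (k + 1)) - (g (k + 1) - g k) ≤ 1 := by linarith
        nlinarith
    rw [Real.sin_sub] at h3
    simp only [hC]
    rw [div_le_div_iff₀ (by linarith) (by linarith)]
    linarith
  -- The increments of `c` are purely imaginary of constant sign, since the cotangent decreases
  -- along `θ`; their total variation therefore telescopes.
  have hind : ∀ m, m < n → ‖∑ k ∈ Finset.range (m + 1), unitExp (g k)
      + unitExp (g (m + 1)) * c m‖ ≤ ‖c 0‖ + (C 0 - C m) / 2 := by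
    intro m
    induction m with
    | zero =>
      intro h0
      have e : ∑ k ∈ Finset.range (0 + 1), unitExp (g k) + unitExp (g (0 + 1)) * c 0
          = unitExp (g 0) * c 0 := by
        rw [zero_add, Finset.sum_range_one]
        linear_combination hstep 0 h0
      rw [e, norm_mul, norm_unitExp]
      simp
    | succ m ih =>
      intro hm
      have h1 := ih (by omega)
      have e : ∑ k ∈ Finset.range (m + 1 + 1), unitExp (g k) + unitExp (g (m + 1 + 1)) * c (m + 1)
          = (∑ k ∈ Finset.range (m + 1), unitExp (g k) + unitExp (g (m + 1)) * c m)
            + unitExp (g (m + 1)) * (c (m + 1) - c m) := by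
        rw [Finset.sum_range_succ]
        linear_combination hstep (m + 1) hm
      have h2 : ‖c (m + 1) - c m‖ = (C m - C (m + 1)) / 2 := by
        have : c (m + 1) - c m = Complex.I * (((C (m + 1) - C m) / 2 : ℝ) : ℂ) := by
          simp only [hc]; push_cast; ring
        rw [this, norm_mul, Complex.norm_I, one_mul, Complex.norm_real, Real.norm_eq_abs,
          abs_of_nonpos (by have := hCmono m hm; linarith)]
        ring
      rw [e]
      refine (norm_add_le _ _).trans ?_
      rw [norm_mul, norm_unitExp, one_mul, h2]
      linarith
  rcases Nat.eq_zero_or_pos n with rfl | hn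
  · simp [hδ.le]
  · obtain ⟨m, rfl⟩ : ∃ m, n = m + 1 := ⟨n - 1, by omega⟩
    have h1 := hind m (by omega)
    have h2 := hcn 0 hn
    have h3 := hcn m (by omega)
    have h4 := abs_le.mp (hCabs 0 hn)
    have h5 := abs_le.mp (hCabs m (by omega))
    have h6 : ‖∑ k ∈ Finset.range (m + 1), unitExp (g k)‖ ≤
        ‖∑ k ∈ Finset.range (m + 1), unitExp (g k) + unitExp (g (m + 1)) * c m‖ + ‖c m‖ := by
      have := norm_sub_le (∑ k ∈ Finset.range (m + 1), unitExp (g k) + unitExp (g (m + 1)) * c m)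
        (unitExp (g (m + 1)) * c m)
      rwa [add_sub_cancel_right, norm_mul (unitExp _), norm_unitExp, one_mul] at this
    -- The two boundary values of `c` cost `1/(4δ)` each, and the variation of `C / 2` costs at most
    -- `1/(2δ)`.
    have e : 1 / δ = 1 / (4 * δ) + 1 / (4 * δ) + (1 / (2 * δ) + 1 / (2 * δ)) / 2 := by
      field_simp; norm_num
    rw [e]
    linarith

theorem norm_sum_Ico_unitExp_le {g : ℕ → ℝ} {δ : ℝ} (hδ : 0 < δ) {m n : ℕ}
    (hmono : ∀ k, m ≤ k → k + 1 < n → g (k + 1) - g k ≤ g (k + 2) - g (k + 1))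
    (hlo : ∀ k, m ≤ k → k < n → δ ≤ g (k + 1) - g k)
    (hhi : ∀ k, m ≤ k → k < n → g (k + 1) - g k ≤ 1 - δ) :
    ‖∑ k ∈ Finset.Ico m n, unitExp (g k)‖ ≤ 1 / δ := by
  rw [Finset.sum_Ico_eq_sum_range]
  refine norm_sum_range_unitExp_le (g := fun k => g (m + k)) hδ (n - m) ?_ ?_ ?_
  · intro k hk; exact hmono (m + k) (by omega) (by omega)
  · intro k hk; exact hlo (m + k) (by omega) (by omega)
  · intro k hk; exact hhi (m + k) (by omega) (by omega)

/-! ### Riemann sums and Fresnel integrals -/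

/-- A Riemann sum estimate with arbitrary nodes. -/
theorem norm_riemannSum_sub_integral_le {E : ℝ → ℂ} (hE : Continuous E) {η : ℕ → ℝ}
    (hη : Monotone η) {F : ℕ → ℂ} {m n : ℕ} (hmn : m ≤ n) {ε : ℝ}
    (h : ∀ k, m ≤ k → k < n → ∀ x, η k ≤ x → x ≤ η (k + 1) → ‖F k - E x‖ ≤ ε) :
    ‖(∑ k ∈ Finset.Ico m n, ((η (k + 1) - η k : ℝ) : ℂ) * F k) - ∫ x in η m..η n, E x‖
      ≤ ε * (η n - η m) := by
  rw [← intervalIntegral.sum_integral_adjacent_intervals_Ico hmn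
    (fun k _ => hE.intervalIntegrable _ _), ← Finset.sum_sub_distrib]
  have htel : ε * (η n - η m) = ∑ k ∈ Finset.Ico m n, ε * (η (k + 1) - η k) := by
    rw [← Finset.mul_sum, Finset.sum_Ico_sub _ hmn]
  rw [htel]
  refine norm_sum_le_of_le _ fun k hk => ?_
  rw [Finset.mem_Ico] at hk
  have hle : η k ≤ η (k + 1) := hη k.le_succ
  have e : ((η (k + 1) - η k : ℝ) : ℂ) * F k - ∫ x in η k..η (k + 1), E x
      = ∫ x in η k..η (k + 1), (F k - E x) := by
    rw [intervalIntegral.integral_sub (by simp) (hE.intervalIntegrable _ _),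
      intervalIntegral.integral_const, Complex.real_smul]
  rw [e]
  refine (intervalIntegral.norm_integral_le_of_norm_le_const (C := ε) fun x hx => ?_).trans ?_
  · rw [Set.uIoc_of_le hle] at hx
    exact h k hk.1 hk.2 x hx.1.le hx.2
  · rw [abs_of_nonneg (by linarith)]

/-- Integration by parts: the boundary terms give at most `1/(2K) + 1/(2R)` and the remaining
integral at most `1/(2K) - 1/(2R)`. The bound is uniform down to `Re b = 0`, which makes the passage
to Fresnel integrals possible. -/
theorem norm_integral_cexp_neg_mul_sq_le {b : ℂ} (hb : 0 ≤ b.re) (hb1 : 1 ≤ ‖b‖) {K R : ℝ}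
    (hK : 0 < K) (hKR : K ≤ R) :
    ‖∫ x in K..R, Complex.exp (-b * (x : ℂ) ^ 2)‖ ≤ 1 / K := by
  have hb0 : b ≠ 0 := fun h => by norm_num [h] at hb1
  have hnorm : ∀ x : ℝ, ‖Complex.exp (-b * (x : ℂ) ^ 2)‖ ≤ 1 := by
    intro x
    rw [Complex.norm_exp, Real.exp_le_one_iff, ← Complex.ofReal_pow, Complex.re_mul_ofReal]
    simp only [Complex.neg_re]
    nlinarith [sq_nonneg x]
  have hpos : ∀ x ∈ Set.uIcc K R, 0 < x := fun x hx => by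
    rw [Set.uIcc_of_le hKR] at hx; linarith [hx.1]
  set G : ℝ → ℂ := fun x => -Complex.exp (-b * (x : ℂ) ^ 2) / (2 * b * x) with hG
  have hderiv : ∀ x ∈ Set.uIcc K R, HasDerivAt G
      (Complex.exp (-b * (x : ℂ) ^ 2) + Complex.exp (-b * (x : ℂ) ^ 2) / (2 * b * (x : ℂ) ^ 2)) x := by
    intro x hx
    have hx0 : (x : ℂ) ≠ 0 := Complex.ofReal_ne_zero.mpr (hpos x hx).ne'
    have h1 : HasDerivAt (fun z : ℂ => -Complex.exp (-b * z ^ 2) / (2 * b * z))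
        (Complex.exp (-b * (x : ℂ) ^ 2) + Complex.exp (-b * (x : ℂ) ^ 2) / (2 * b * (x : ℂ) ^ 2))
        (x : ℂ) := by
      have h2 : HasDerivAt (fun z : ℂ => -b * z ^ 2) (-b * (2 * (x : ℂ))) (x : ℂ) := by
        simpa using (hasDerivAt_pow 2 (x : ℂ)).const_mul (-b)
      have h3 := h2.cexp.neg
      have h4 : HasDerivAt (fun z : ℂ => 2 * b * z) (2 * b) (x : ℂ) := by
        simpa using (hasDerivAt_id (x : ℂ)).const_mul (2 * b)
      have h5 := h3.div h4 (by simp [hb0, hx0])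
      refine h5.congr_deriv ?_
      simp only [Pi.neg_apply]
      field_simp
      ring
    exact h1.comp_ofReal
  have hc1 : ContinuousOn (fun x : ℝ => Complex.exp (-b * (x : ℂ) ^ 2)) (Set.uIcc K R) := by fun_prop
  have hc2 : ContinuousOn (fun x : ℝ => Complex.exp (-b * (x : ℂ) ^ 2) / (2 * b * (x : ℂ) ^ 2))
      (Set.uIcc K R) := by
    refine hc1.div (by fun_prop) fun x hx => ?_
    have hx0 : (x : ℂ) ≠ 0 := Complex.ofReal_ne_zero.mpr (hpos x hx).ne'
    simp [hb0, hx0]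
  have hint := intervalIntegral.integral_eq_sub_of_hasDerivAt hderiv
    (hc1.add hc2).intervalIntegrable
  rw [intervalIntegral.integral_add hc1.intervalIntegrable hc2.intervalIntegrable] at hint
  have hGn : ∀ x, 0 < x → ‖G x‖ ≤ 1 / (2 * x) := by
    intro x hx
    rw [hG, norm_div, norm_neg, norm_mul, norm_mul, Complex.norm_real, Real.norm_eq_abs,
      abs_of_pos hx, Complex.norm_ofNat]
    refine div_le_div₀ zero_le_one (hnorm x) (by positivity) ?_
    nlinarith
  have hR0 : 0 < R := by linarith
  have hrem : ‖∫ x in K..R, Complex.exp (-b * (x : ℂ) ^ 2) / (2 * b * (x : ℂ) ^ 2)‖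
      ≤ 1 / (2 * K) - 1 / (2 * R) := by
    have hI : ∫ x in K..R, (2 * x ^ 2)⁻¹ = 1 / (2 * K) - 1 / (2 * R) := by
      have hd : ∀ x ∈ Set.uIcc K R, HasDerivAt (fun x : ℝ => -(1 / 2) * x⁻¹) ((2 * x ^ 2)⁻¹) x := by
        intro x hx
        have hx0 := (hpos x hx).ne'
        refine ((hasDerivAt_inv hx0).const_mul (-(1 / 2))).congr_deriv ?_
        field_simp
      rw [intervalIntegral.integral_eq_sub_of_hasDerivAt hd]
      · field_simp; ring
      · refine ContinuousOn.intervalIntegrable ?_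
        refine ContinuousOn.inv₀ (by fun_prop) fun x hx => ?_
        have := hpos x hx; positivity
    rw [← hI]
    refine intervalIntegral.norm_integral_le_of_norm_le hKR ?_ ?_
    · refine Eventually.of_forall fun x hx => ?_
      have hx0 : 0 < x := hK.trans hx.1
      rw [norm_div, norm_mul, norm_mul, norm_pow, Complex.norm_real, Real.norm_eq_abs,
        abs_of_pos hx0, Complex.norm_ofNat, ← one_div]
      refine div_le_div₀ zero_le_one (hnorm x) (by positivity) ?_
      have : 0 < x ^ 2 := by positivity
      nlinarith
    · refine ContinuousOn.intervalIntegrable ?_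
      refine ContinuousOn.inv₀ (by fun_prop) fun x hx => ?_
      have := hpos x hx; positivity
  have hfin : ∫ x in K..R, Complex.exp (-b * (x : ℂ) ^ 2)
      = G R - G K - ∫ x in K..R, Complex.exp (-b * (x : ℂ) ^ 2) / (2 * b * (x : ℂ) ^ 2) := by
    linear_combination hint
  rw [hfin]
  have h1 := norm_sub_le (G R - G K)
    (∫ x in K..R, Complex.exp (-b * (x : ℂ) ^ 2) / (2 * b * (x : ℂ) ^ 2))
  have h2 := norm_sub_le (G R) (G K)
  have h3 := hGn R hR0
  have h4 := hGn K hK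
  have e : 1 / K = 1 / (2 * K) + 1 / (2 * K) := by field_simp; norm_num
  rw [e]
  linarith

/-- By evenness the difference is twice a tail on `[K, R]` with `R → ∞`. -/
theorem norm_gaussian_sub_integral_le {b : ℂ} (hb : 0 < b.re) (hb1 : 1 ≤ ‖b‖) {K : ℝ}
    (hK : 0 < K) :
    ‖(Real.pi / b) ^ (1 / 2 : ℂ) - ∫ x in -K..K, Complex.exp (-b * (x : ℂ) ^ 2)‖ ≤ 2 / K := by
  have hcont : Continuous fun x : ℝ => Complex.exp (-b * (x : ℂ) ^ 2) := by fun_prop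
  have hlim := intervalIntegral_tendsto_integral (integrable_cexp_neg_mul_sq hb)
    tendsto_neg_atTop_atBot tendsto_id
  rw [integral_gaussian_complex hb] at hlim
  refine le_of_tendsto (hlim.sub_const _).norm ?_
  filter_upwards [eventually_ge_atTop K] with R hR
  have e1 : ∫ x in -R..-K, Complex.exp (-b * (x : ℂ) ^ 2)
      = ∫ x in K..R, Complex.exp (-b * (x : ℂ) ^ 2) := by
    rw [← intervalIntegral.integral_comp_neg]
    simp
  have e2 : (∫ x in -R..R, Complex.exp (-b * (x : ℂ) ^ 2))
      - ∫ x in -K..K, Complex.exp (-b * (x : ℂ) ^ 2)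
      = 2 * ∫ x in K..R, Complex.exp (-b * (x : ℂ) ^ 2) := by
    have h1 := intervalIntegral.integral_add_adjacent_intervals
      (hcont.intervalIntegrable (μ := volume) (-R) (-K)) (hcont.intervalIntegrable (-K) K)
    have h2 := intervalIntegral.integral_add_adjacent_intervals
      (hcont.intervalIntegrable (μ := volume) (-R) K) (hcont.intervalIntegrable K R)
    rw [e1] at h1
    linear_combination -h1 - h2
  simp only [id]
  rw [e2, norm_mul, Complex.norm_ofNat]
  have := norm_integral_cexp_neg_mul_sq_le hb.le hb1 hK hR
  calc 2 * ‖∫ x in K..R, Complex.exp (-b * (x : ℂ) ^ 2)‖ ≤ 2 * (1 / K) := by linarith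
    _ = 2 / K := by ring

/-- Truncated Fresnel integrals. -/
theorem norm_fresnel_sub_integral_le {K : ℝ} (hK : 0 < K) :
    ‖(1 / (2 * Complex.I)) ^ (1 / 2 : ℂ) - ∫ x in -K..K, unitExp (-x ^ 2)‖ ≤ 2 / K := by
  -- The Fresnel integral is approached by Gaussians with parameter `ε + 2πi`, `ε → 0⁺`. The
  -- truncation error is uniform in `ε`, and the principal root is continuous at the limit `1/(2i)`.
  set B : ℝ → ℂ := fun ε => (ε : ℂ) + 2 * Real.pi * Complex.I with hB
  have hBc : Continuous B := by fun_prop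
  have hpi : (Real.pi : ℂ) ≠ 0 := Complex.ofReal_ne_zero.mpr Real.pi_ne_zero
  have h1 : Tendsto (fun ε : ℝ => (Real.pi / B ε) ^ (1 / 2 : ℂ)) (𝓝[>] 0)
      (𝓝 ((1 / (2 * Complex.I)) ^ (1 / 2 : ℂ))) := by
    have e : (Real.pi : ℂ) / B 0 = 1 / (2 * Complex.I) := by
      simp only [hB, Complex.ofReal_zero, zero_add]
      field_simp
    have hc : ContinuousAt (fun ε : ℝ => (Real.pi / B ε) ^ (1 / 2 : ℂ)) 0 := by
      refine ContinuousAt.cpow (ContinuousAt.div continuousAt_const hBc.continuousAt ?_)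
        continuousAt_const ?_
      · simp [hB, hpi]
      · rw [e, Complex.mem_slitPlane_iff]
        right
        simp
    have := hc.tendsto
    rw [e] at this
    exact this.mono_left nhdsWithin_le_nhds
  have h2 : Tendsto (fun ε : ℝ => ∫ x in -K..K, Complex.exp (-B ε * (x : ℂ) ^ 2)) (𝓝[>] 0)
      (𝓝 (∫ x in -K..K, unitExp (-x ^ 2))) := by
    have hc : Continuous fun ε : ℝ => ∫ x in -K..K, Complex.exp (-B ε * (x : ℂ) ^ 2) :=
      intervalIntegral.continuous_parametric_intervalIntegral_of_continuous' (by fun_prop) _ _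
    have h3 := hc.tendsto 0
    have e : ∫ x in -K..K, Complex.exp (-B 0 * (x : ℂ) ^ 2) = ∫ x in -K..K, unitExp (-x ^ 2) := by
      refine intervalIntegral.integral_congr fun x _ => ?_
      simp only [hB, unitExp]
      congr 1
      push_cast
      ring
    rw [e] at h3
    exact h3.mono_left nhdsWithin_le_nhds
  refine le_of_tendsto (h1.sub h2).norm ?_
  filter_upwards [self_mem_nhdsWithin] with ε hε
  have hε0 : (0 : ℝ) < ε := hε
  refine norm_gaussian_sub_integral_le (by simpa [hB] using hε0) ?_ hK
  have him : (B ε).im = 2 * Real.pi := by simp [hB]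
  have := Complex.abs_im_le_norm (B ε)
  rw [him, abs_of_pos Real.two_pi_pos] at this
  have := Real.pi_gt_three
  linarith

/-! ### Stationary phase: windows and gaps -/

/-- Left end of the window of length of order `√j` around the `j`-th stationary point of
`s * k ^ (3 / 2) - j * k`. -/
noncomputable def windowLo (s κ : ℝ) (j : ℕ) : ℕ := ⌊(2 * j / (3 * s) - κ / √j) ^ 2⌋₊

/-- Right end of the window of length of order `√j` around the `j`-th stationary point of
`s * k ^ (3 / 2) - j * k`. -/
noncomputable def windowHi (s κ : ℝ) (j : ℕ) : ℕ := ⌈(2 * j / (3 * s) + κ / √j) ^ 2⌉₊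

/-- With `u = √k` and `v = √(k+1)`, the increment of `k^(3/2)` lies between the derivatives at the
two ends; both defects are a square times a nonnegative factor. In particular the increments are
monotone in `k`. -/
theorem cube_sub_cube_bounds {u v : ℝ} (hu : 0 ≤ u) (huv : u ≤ v) (h : v ^ 2 = u ^ 2 + 1) :
    3 / 2 * u ≤ v ^ 3 - u ^ 3 ∧ v ^ 3 - u ^ 3 ≤ 3 / 2 * v := by
  have h1 : 2 * (v ^ 3 - u ^ 3) - 3 * u = (v - u) ^ 2 * (2 * v + u) := by
    linear_combination (3 * u) * h
  have h2 : 3 * v - 2 * (v ^ 3 - u ^ 3) = (v - u) ^ 2 * (v + 2 * u) := by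
    linear_combination (-3 * v) * h
  have h3 : 0 ≤ (v - u) ^ 2 * (2 * v + u) := by
    have : 0 ≤ 2 * v + u := by linarith
    positivity
  have h4 : 0 ≤ (v - u) ^ 2 * (v + 2 * u) := by
    have : 0 ≤ v + 2 * u := by linarith
    positivity
  constructor <;> linarith

theorem sqrt_cube_sub_bounds (k : ℕ) :
    3 / 2 * √(k : ℝ) ≤ √((k + 1 : ℕ) : ℝ) ^ 3 - √(k : ℝ) ^ 3 ∧
      √((k + 1 : ℕ) : ℝ) ^ 3 - √(k : ℝ) ^ 3 ≤ 3 / 2 * √((k + 1 : ℕ) : ℝ) := by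
  refine cube_sub_cube_bounds (Real.sqrt_nonneg _) (Real.sqrt_le_sqrt (by push_cast; linarith)) ?_
  rw [Real.sq_sqrt (by positivity), Real.sq_sqrt (by positivity)]
  push_cast; ring

/-- The sum over the range between two consecutive windows. -/
theorem norm_sum_gap_le {s κ : ℝ} (hs : 0 < s) (hκ : 0 < κ) {j : ℕ} (hj : 0 < j)
    (hq : 0 ≤ 2 * (j + 1 : ℕ) / (3 * s) - κ / √(j + 1 : ℕ)) :
    ‖∑ k ∈ Finset.Ico (windowHi s κ j) (windowLo s κ (j + 1)), unitExp (-(s * √(k : ℝ) ^ 3))‖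
      ≤ 2 * √(j + 1 : ℕ) / (3 * s * κ) := by
  have hr' : 0 < √((j + 1 : ℕ) : ℝ) := Real.sqrt_pos.mpr (by positivity)
  -- Conjugation makes the phase increments increasing, and subtracting the integer `j k` moves them
  -- into `(0, 1)`.
  have hnorm : ‖∑ k ∈ Finset.Ico (windowHi s κ j) (windowLo s κ (j + 1)),
      unitExp (-(s * √(k : ℝ) ^ 3))‖
      = ‖∑ k ∈ Finset.Ico (windowHi s κ j) (windowLo s κ (j + 1)),
        unitExp (s * √(k : ℝ) ^ 3 - j * k)‖ := by
    rw [← Complex.norm_conj, map_sum]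
    congr 1
    refine Finset.sum_congr rfl fun k _ => ?_
    rw [← unitExp_neg, neg_neg, unitExp_sub,
      show ((j : ℝ) * k) = ((j * k : ℕ) : ℝ) by push_cast; ring, unitExp_natCast, map_one, mul_one]
  -- The distance `δ` from the integers is `3sκ/(2√(j+1))`: outside the windows `√k` stays
  -- `κ/√(j+1)` away from both stationary points, and the increment is about `(3/2) s √k`.
  have e : 2 * √((j + 1 : ℕ) : ℝ) / (3 * s * κ) = 1 / (3 / 2 * s * κ / √((j + 1 : ℕ) : ℝ)) := by
    field_simp
  rw [hnorm, e]
  have hd : ∀ k : ℕ, (s * √((k + 1 : ℕ) : ℝ) ^ 3 - j * (k + 1 : ℕ)) - (s * √(k : ℝ) ^ 3 - j * k)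
      = s * (√((k + 1 : ℕ) : ℝ) ^ 3 - √(k : ℝ) ^ 3) - j := by
    intro k; push_cast; ring
  refine norm_sum_Ico_unitExp_le (g := fun k : ℕ => s * √(k : ℝ) ^ 3 - j * k) (by positivity)
    ?_ ?_ ?_
  · intro k _ _
    have h1 := (sqrt_cube_sub_bounds k).2
    have h2 := (sqrt_cube_sub_bounds (k + 1)).1
    have h3 := mul_le_mul_of_nonneg_left (h1.trans h2) hs.le
    have e1 := hd k
    have e2 := hd (k + 1)
    simp only [add_assoc, Nat.reduceAdd] at e1 e2 h3 ⊢
    rw [e1, e2]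
    linarith
  · intro k hk _
    rw [hd]
    have h1 := mul_le_mul_of_nonneg_left (sqrt_cube_sub_bounds k).1 hs.le
    have h2 : 2 * j / (3 * s) + κ / √(j : ℝ) ≤ √(k : ℝ) :=
      Real.le_sqrt_of_sq_le (Nat.ceil_le.mp hk)
    have hr : 0 < √(j : ℝ) := Real.sqrt_pos.mpr (by exact_mod_cast hj)
    have h3 : κ / √((j + 1 : ℕ) : ℝ) ≤ κ / √(j : ℝ) :=
      div_le_div_of_nonneg_left hκ.le hr (Real.sqrt_le_sqrt (by push_cast; linarith))
    have h4 : s * (3 / 2 * (2 * j / (3 * s) + κ / √((j + 1 : ℕ) : ℝ)))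
        = j + 3 / 2 * s * κ / √((j + 1 : ℕ) : ℝ) := by
      field_simp
    have h5 : s * (3 / 2 * (2 * j / (3 * s) + κ / √((j + 1 : ℕ) : ℝ))) ≤ s * (3 / 2 * √(k : ℝ)) := by
      refine mul_le_mul_of_nonneg_left ?_ hs.le
      linarith
    linarith
  · intro k _ hk
    rw [hd]
    have h1 := mul_le_mul_of_nonneg_left (sqrt_cube_sub_bounds k).2 hs.le
    have h2 : √((k + 1 : ℕ) : ℝ) ≤ 2 * (j + 1 : ℕ) / (3 * s) - κ / √(j + 1 : ℕ) := by
      rw [Real.sqrt_le_left hq]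
      exact (Nat.le_floor_iff (sq_nonneg _)).mp hk
    have h4 : s * (3 / 2 * (2 * (j + 1 : ℕ) / (3 * s) - κ / √((j + 1 : ℕ) : ℝ)))
        = j + 1 - 3 / 2 * s * κ / √((j + 1 : ℕ) : ℝ) := by
      field_simp; push_cast; ring
    have h5 := mul_le_mul_of_nonneg_left (mul_le_mul_of_nonneg_left h2
      (show (0 : ℝ) ≤ 3 / 2 by norm_num)) hs.le
    linarith

/-- Source of the duality: the cubic `s y³ - j y²` in `y = √k`, expanded at `y = 2j/(3s)`, has no
linear term, constant `-4j³/(27s²)` and quadratic coefficient `j`. The variable `η` rescales the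
quadratic part to `η²`, and the multiple `j k` is invisible to the character. -/
theorem unitExp_neg_sqrt_cube {s r : ℝ} (hs : 0 < s) (hr : 0 < r) (j k : ℕ) (hj : r ^ 2 = j)
    {η : ℝ} (hη : η = r * (√(k : ℝ) - 2 * j / (3 * s))) :
    unitExp (-(s * √(k : ℝ) ^ 3))
      = unitExp (4 / (27 * s ^ 2) * (j : ℝ) ^ 3) * unitExp (-(η ^ 2 + s * η ^ 3 / r ^ 3)) := by
  have hk : √(k : ℝ) ^ 2 = k := Real.sq_sqrt (Nat.cast_nonneg k)
  have h1 : -(s * √(k : ℝ) ^ 3) = (4 / (27 * s ^ 2) * (j : ℝ) ^ 3 + -(η ^ 2 + s * η ^ 3 / r ^ 3))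
      - ((j * k : ℕ) : ℝ) := by
    have h2 : s * η ^ 3 / r ^ 3 = s * (√(k : ℝ) - 2 * j / (3 * s)) ^ 3 := by
      rw [hη]; field_simp
    have h3 : η ^ 2 = j * (√(k : ℝ) - 2 * j / (3 * s)) ^ 2 := by
      rw [hη, mul_pow, hj]
    rw [h2, h3]
    push_cast
    nth_rewrite 4 [← hk]
    field_simp
    ring
  rw [h1, unitExp_sub, unitExp_natCast, map_one, mul_one, unitExp_add]

theorem ratio_sub_one_eq {s r w : ℝ} (hs : 0 < s) (hr : 0 < r) (hw : w = 2 * r ^ 2 / (3 * s))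
    (A B : ℝ) : 3 * s / 4 * (A + B) / r ^ 2 - 1
      = 3 * s / 4 * (r * (A - w) + r * (B - w)) / r ^ 3 := by
  rw [hw]
  field_simp
  ring

set_option maxHeartbeats 1000000 in
/-- The sum over a window is a Riemann sum for a truncated Fresnel integral. -/
theorem norm_sum_window_sub_le {s κ : ℝ} (hs : 0 < s) (hκ : 0 < κ) {j : ℕ} {r : ℝ}
    (hrj : r = √(j : ℝ)) (hr1 : 1 ≤ r) (hr2 : 3 * s ≤ r) (hr3 : 3 * s * (κ + 1) ≤ r) :
    ‖∑ k ∈ Finset.Ico (windowLo s κ j) (windowHi s κ j), unitExp (-(s * √(k : ℝ) ^ 3))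
      - (r : ℂ) * ((4 / (3 * s) : ℝ) * ∫ x in -κ..κ, unitExp (-x ^ 2))
        * unitExp (4 / (27 * s ^ 2) * (j : ℝ) ^ 3)‖
      ≤ 4 / (3 * s) * ((3 / 2 * s * (κ + 1)
        + 2 * Real.pi * (3 * s * (κ + 1) + s * (κ + 1) ^ 3)) * (2 * κ + 2) + 6 * s) := by
  have hr0 : 0 < r := by linarith
  have hj : r ^ 2 = j := by rw [hrj, Real.sq_sqrt (Nat.cast_nonneg j)]
  set w : ℝ := 2 * j / (3 * s) with hw
  have hw' : w = 2 * r ^ 2 / (3 * s) := by rw [hw, hj]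
  have hr_sq : r ≤ r ^ 2 := by nlinarith
  have hr_cu : r ≤ r ^ 3 := by nlinarith
  have hwr : 2 * r ≤ w := by
    rw [hw', le_div_iff₀ (by positivity)]
    nlinarith
  have hκr : (κ + 1) / r ≤ w / 2 := by
    rw [hw', div_le_iff₀ hr0]
    have : 2 * r ^ 2 / (3 * s) / 2 * r = r ^ 3 / (3 * s) := by field_simp
    rw [this, le_div_iff₀ (by positivity)]
    linarith
  have hκr' : κ / r ≤ w / 2 := le_trans (div_le_div_of_nonneg_right (by linarith) hr0.le) hκr
  set a : ℝ := w - κ / r with ha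
  set b : ℝ := w + κ / r with hb
  have hκr0 : 0 < κ / r := by positivity
  have haw : w / 2 ≤ a := by rw [ha]; linarith
  have har : r ≤ a := by linarith
  have ha0 : 0 < a := by linarith
  have hb0 : 0 < b := by rw [hb]; linarith
  have hra : r * (1 / a) ≤ 3 * s / r := by
    have h1 : r ^ 2 / (3 * s) ≤ a := by
      refine le_trans (le_of_eq ?_) haw
      rw [hw']; field_simp
    rw [mul_one_div, div_le_div_iff₀ ha0 hr0]
    rw [div_le_iff₀ (by positivity)] at h1
    nlinarith
  have hsr : 3 * s / r ≤ 1 := by rw [div_le_one hr0]; exact hr2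
  set m := windowLo s κ j with hm
  set n := windowHi s κ j with hn
  have hm' : m = ⌊a ^ 2⌋₊ := by rw [hm, windowLo, ← hrj]
  have hn' : n = ⌈b ^ 2⌉₊ := by rw [hn, windowHi, ← hrj]
  set η : ℕ → ℝ := fun k => r * (√(k : ℝ) - w) with hη
  have hmono : Monotone η := by
    intro k l hkl
    have : √(k : ℝ) ≤ √(l : ℝ) := Real.sqrt_le_sqrt (by exact_mod_cast hkl)
    simp only [hη]
    nlinarith
  have hmn : m ≤ n := by
    have h1 : (m : ℝ) ≤ a ^ 2 := by rw [hm']; exact Nat.floor_le (sq_nonneg _)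
    have h2 : b ^ 2 ≤ (n : ℝ) := by rw [hn']; exact Nat.le_ceil _
    have h3 : a ^ 2 ≤ b ^ 2 := by
      refine pow_le_pow_left₀ ha0.le ?_ 2
      rw [ha, hb]; linarith
    exact_mod_cast h1.trans (h3.trans h2)
  -- Rounding changes `a²` by less than 1, so its root by at most `1/a`; in the variable `η` this is
  -- at most `3s/r ≤ 1`.
  have hηm : -κ - 3 * s / r ≤ η m ∧ η m ≤ -κ := by
    have hub : √(m : ℝ) ≤ a := by
      rw [Real.sqrt_le_left ha0.le, hm']
      exact Nat.floor_le (sq_nonneg _)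
    have hlb : a - 1 / a ≤ √(m : ℝ) := by
      refine Real.le_sqrt_of_sq_le ?_
      have h1 : a ^ 2 < (m : ℝ) + 1 := by rw [hm']; exact Nat.lt_floor_add_one _
      have h2 : (a - 1 / a) ^ 2 = a ^ 2 - 2 + (1 / a) ^ 2 := by field_simp; ring
      have h3 : 1 / a ≤ 1 := by rw [div_le_one ha0]; linarith
      have h4 : (1 / a) ^ 2 ≤ 1 := pow_le_one₀ (by positivity) h3
      linarith
    have e : r * (a - w) = -κ := by rw [ha]; field_simp; ring
    constructor
    · have := mul_le_mul_of_nonneg_left hlb hr0.le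
      simp only [hη]
      linarith
    · have := mul_le_mul_of_nonneg_left hub hr0.le
      simp only [hη]
      linarith
  have hηn : κ ≤ η n ∧ η n ≤ κ + 3 * s / r := by
    have hlb : b ≤ √(n : ℝ) := by
      refine Real.le_sqrt_of_sq_le ?_
      rw [hn']; exact Nat.le_ceil _
    have hub : √(n : ℝ) ≤ b + 1 / a := by
      rw [Real.sqrt_le_left (by positivity)]
      have h1 : (n : ℝ) < b ^ 2 + 1 := by rw [hn']; exact Nat.ceil_lt_add_one (sq_nonneg _)
      have h2 : 1 ≤ b * (1 / a) := by
        rw [mul_one_div, le_div_iff₀ ha0, ha, hb]; linarith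
      have h3 : 0 ≤ (1 / a) ^ 2 := by positivity
      nlinarith
    have e : r * (b - w) = κ := by rw [hb]; field_simp; ring
    constructor
    · have := mul_le_mul_of_nonneg_left hlb hr0.le
      simp only [hη]
      linarith
    · have := mul_le_mul_of_nonneg_left hub hr0.le
      simp only [hη]
      linarith
  set K := κ + 1 with hK
  have hK0 : 0 < K := by linarith
  have hηabs : ∀ k, m ≤ k → k ≤ n → |η k| ≤ K := by
    intro k h1 h2
    have h3 := hmono h1
    have h4 := hmono h2
    rw [abs_le]
    constructor <;> linarith [hηm.1, hηn.2]
  -- The nodes `η k` are not equally spaced. The weight `ρ k`, close to 1, makes `(η (k+1) - η k) ρ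
  -- k` equal to the constant `3s/(4r)`, so the unweighted sum becomes a Riemann sum.
  set ρ : ℕ → ℝ := fun k => 3 * s / 4 * (√((k + 1 : ℕ) : ℝ) + √(k : ℝ)) / r ^ 2 with hρ
  have hΔρ : ∀ k, (η (k + 1) - η k) * ρ k = 3 * s / 4 / r := by
    intro k
    have h1 : (√((k + 1 : ℕ) : ℝ) - √(k : ℝ)) * (√((k + 1 : ℕ) : ℝ) + √(k : ℝ)) = 1 := by
      have h2 := Real.sq_sqrt (Nat.cast_nonneg (α := ℝ) (k + 1))
      have h3 := Real.sq_sqrt (Nat.cast_nonneg (α := ℝ) k)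
      push_cast at h2 ⊢
      linear_combination h2 - h3
    have h4 : (η (k + 1) - η k) * ρ k = 3 * s / 4 / r *
        ((√((k + 1 : ℕ) : ℝ) - √(k : ℝ)) * (√((k + 1 : ℕ) : ℝ) + √(k : ℝ))) := by
      simp only [hη, hρ]
      field_simp
      ring
    rw [h4, h1, mul_one]
  have hρ1 : ∀ k, m ≤ k → k < n → |ρ k - 1| ≤ 3 / 2 * s * K / r ^ 3 := by
    intro k h1 h2
    have e : ρ k - 1 = 3 * s / 4 * (η (k + 1) + η k) / r ^ 3 := by
      simp only [hη, hρ]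
      exact ratio_sub_one_eq hs hr0 hw' _ _
    have h3 : |η (k + 1) + η k| ≤ 2 * K := by
      have := abs_add_le (η (k + 1)) (η k)
      have := hηabs k h1 h2.le
      have := hηabs (k + 1) (by omega) (by omega)
      linarith
    rw [e, abs_div, abs_mul, abs_of_pos (show 0 < r ^ 3 by positivity),
      abs_of_pos (show 0 < 3 * s / 4 by positivity)]
    refine div_le_div_of_nonneg_right ?_ (by positivity)
    nlinarith
  have hr3inv : 1 / r ^ 3 ≤ 1 / r := one_div_le_one_div_of_le hr0 hr_cu
  have hρr : ∀ k, m ≤ k → k < n → |ρ k - 1| ≤ 3 / 2 * s * K / r := by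
    intro k h1 h2
    refine (hρ1 k h1 h2).trans ?_
    exact div_le_div_of_nonneg_left (by positivity) hr0 hr_cu
  have hρhalf : ∀ k, m ≤ k → k < n → 1 / 2 ≤ ρ k := by
    intro k h1 h2
    have h3 := (abs_le.mp (hρr k h1 h2)).1
    have h4 : 3 / 2 * s * K / r ≤ 1 / 2 := by
      rw [div_le_iff₀ hr0]; linarith
    linarith
  have hΔ : ∀ k, m ≤ k → k < n → η (k + 1) - η k ≤ 3 / 2 * s / r := by
    intro k h1 h2
    have h3 := hΔρ k
    have h4 := hρhalf k h1 h2
    have h5 : 0 ≤ η (k + 1) - η k := sub_nonneg.mpr (hmono k.le_succ)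
    have h6 : 3 / 2 * s / r = 2 * (3 * s / 4 / r) := by ring
    rw [h6, ← h3]
    nlinarith
  set F : ℕ → ℂ := fun k => unitExp (-(η k ^ 2 + s * η k ^ 3 / r ^ 3)) with hF
  -- The first part is the error of the weight `ρ`. The second is the phase error: the variation of
  -- `x²` over one cell, plus the cubic term of the expansion.
  set ε : ℝ := (3 / 2 * s * K + 2 * Real.pi * (3 * s * K + s * K ^ 3)) / r with hε
  have hEcont : Continuous fun x : ℝ => unitExp (-x ^ 2) := continuous_unitExp.comp (by fun_prop)
  have hriem := norm_riemannSum_sub_integral_le hEcont hmono (F := fun k => (ρ k : ℂ) * F k) hmn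
    (ε := ε) (by
      intro k h1 h2 x hx1 hx2
      have e : (ρ k : ℂ) * F k - unitExp (-x ^ 2)
          = ((ρ k - 1 : ℝ) : ℂ) * F k + (F k - unitExp (-x ^ 2)) := by push_cast; ring
      rw [e]
      refine (norm_add_le _ _).trans ?_
      rw [norm_mul, Complex.norm_real, Real.norm_eq_abs]
      have hF1 : ‖F k‖ = 1 := norm_unitExp _
      rw [hF1, mul_one]
      have h3 := hρr k h1 h2
      have h4 : ‖F k - unitExp (-x ^ 2)‖ ≤ 2 * Real.pi * ((3 * s * K + s * K ^ 3) / r) := by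
        refine (norm_unitExp_sub_le _ _).trans ?_
        refine mul_le_mul_of_nonneg_left ?_ Real.two_pi_pos.le
        have hk1 := hηabs k h1 h2.le
        have hk2 := hηabs (k + 1) (by omega) (by omega)
        have hxk : |x| ≤ K := by
          rw [abs_le] at hk1 hk2 ⊢
          constructor <;> linarith
        have e2 : -(η k ^ 2 + s * η k ^ 3 / r ^ 3) - -x ^ 2
            = (x - η k) * (x + η k) - s * η k ^ 3 / r ^ 3 := by ring
        rw [e2]
        refine (abs_sub _ _).trans ?_
        rw [abs_mul, abs_div, abs_mul, abs_pow, abs_of_pos hs,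
          abs_of_pos (show 0 < r ^ 3 by positivity), add_div]
        refine add_le_add ?_ ?_
        · have h5 : |x - η k| ≤ 3 / 2 * s / r := by
            rw [abs_of_nonneg (by linarith)]
            linarith [hΔ k h1 h2]
          have h6 : |x + η k| ≤ 2 * K := by linarith [abs_add_le x (η k)]
          calc |x - η k| * |x + η k| ≤ 3 / 2 * s / r * (2 * K) :=
                mul_le_mul h5 h6 (abs_nonneg _) (by positivity)
            _ = 3 * s * K / r := by ring
        · refine div_le_div₀ (by positivity) ?_ hr0 hr_cu
          exact mul_le_mul_of_nonneg_left (pow_le_pow_left₀ (abs_nonneg _) hk1 3) hs.le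
      have e3 : ε = 3 / 2 * s * K / r + 2 * Real.pi * ((3 * s * K + s * K ^ 3) / r) := by
        rw [hε]; ring
      rw [e3]
      exact add_le_add h3 h4)
  have hsumF : ∑ k ∈ Finset.Ico m n, ((η (k + 1) - η k : ℝ) : ℂ) * ((ρ k : ℂ) * F k)
      = ((3 * s / 4 / r : ℝ) : ℂ) * ∑ k ∈ Finset.Ico m n, F k := by
    rw [Finset.mul_sum]
    refine Finset.sum_congr rfl fun k _ => ?_
    rw [← mul_assoc, ← Complex.ofReal_mul, hΔρ]
  rw [hsumF] at hriem
  have hintdiff : ‖(∫ x in η m..η n, unitExp (-x ^ 2)) - ∫ x in -κ..κ, unitExp (-x ^ 2)‖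
      ≤ 6 * s / r := by
    have hb1 : ∀ u v : ℝ, ‖∫ x in u..v, unitExp (-x ^ 2)‖ ≤ |v - u| := fun u v => by
      have := intervalIntegral.norm_integral_le_of_norm_le_const (a := u) (b := v) (C := 1)
        (f := fun x : ℝ => unitExp (-x ^ 2)) (fun x _ => (norm_unitExp _).le)
      simpa using this
    have h1 := intervalIntegral.integral_add_adjacent_intervals
      (hEcont.intervalIntegrable (μ := volume) (η m) (-κ)) (hEcont.intervalIntegrable (-κ) κ)
    have h2 := intervalIntegral.integral_add_adjacent_intervals
      (hEcont.intervalIntegrable (μ := volume) (η m) κ) (hEcont.intervalIntegrable κ (η n))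
    have e : (∫ x in η m..η n, unitExp (-x ^ 2)) - ∫ x in -κ..κ, unitExp (-x ^ 2)
        = (∫ x in η m..-κ, unitExp (-x ^ 2)) + ∫ x in κ..η n, unitExp (-x ^ 2) := by
      linear_combination -h1 - h2
    rw [e]
    refine (norm_add_le _ _).trans ?_
    have h3 := hb1 (η m) (-κ)
    have h4 := hb1 κ (η n)
    rw [abs_of_nonneg (by linarith [hηm.2])] at h3
    rw [abs_of_nonneg (by linarith [hηn.1])] at h4
    have e2 : 6 * s / r = 3 * s / r + 3 * s / r := by ring
    rw [e2]
    linarith [hηm.1, hηn.2]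
  have hfactor : ∑ k ∈ Finset.Ico m n, unitExp (-(s * √(k : ℝ) ^ 3))
      = unitExp (4 / (27 * s ^ 2) * (j : ℝ) ^ 3) * ∑ k ∈ Finset.Ico m n, F k := by
    rw [Finset.mul_sum]
    exact Finset.sum_congr rfl fun k _ => unitExp_neg_sqrt_cube hs hr0 j k hj rfl
  have hsC : (s : ℂ) ≠ 0 := Complex.ofReal_ne_zero.mpr hs.ne'
  have hrC : (r : ℂ) ≠ 0 := Complex.ofReal_ne_zero.mpr hr0.ne'
  -- Restoring the factor `4r/(3s)` turns errors of order `1/r` into a constant independent of `j`.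
  have hfinal : ∑ k ∈ Finset.Ico m n, unitExp (-(s * √(k : ℝ) ^ 3))
      - (r : ℂ) * ((4 / (3 * s) : ℝ) * ∫ x in -κ..κ, unitExp (-x ^ 2))
        * unitExp (4 / (27 * s ^ 2) * (j : ℝ) ^ 3)
      = unitExp (4 / (27 * s ^ 2) * (j : ℝ) ^ 3) * ((4 / (3 * s) * r : ℝ) : ℂ) *
        ((((3 * s / 4 / r : ℝ) : ℂ) * (∑ k ∈ Finset.Ico m n, F k)
            - ∫ x in η m..η n, unitExp (-x ^ 2))
          + ((∫ x in η m..η n, unitExp (-x ^ 2)) - ∫ x in -κ..κ, unitExp (-x ^ 2))) := by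
    rw [hfactor]
    push_cast
    field_simp
    ring
  rw [hfinal, norm_mul, norm_mul, norm_unitExp, one_mul, Complex.norm_real, Real.norm_eq_abs,
    abs_of_pos (by positivity)]
  have hε0 : 0 ≤ ε := by rw [hε]; have := Real.pi_pos; positivity
  have hlen : η n - η m ≤ 2 * κ + 2 := by linarith [hηm.1, hηn.2]
  have htot := (norm_add_le _ _).trans
    (add_le_add (hriem.trans (mul_le_mul_of_nonneg_left hlen hε0)) hintdiff)
  refine (mul_le_mul_of_nonneg_left htot (by positivity)).trans (le_of_eq ?_)
  rw [hε]
  field_simp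

/-! ### Sums weighted by `√j` -/

theorem tendsto_sqrt_natCast_atTop : Tendsto (fun j : ℕ => √(j : ℝ)) atTop atTop :=
  Real.tendsto_sqrt_atTop.comp tendsto_natCast_atTop_atTop

/-- The factor 2 absorbs the finitely many terms for which the bound may fail. -/
theorem eventually_norm_sum_le_of_le_sqrt {D : ℕ → ℂ} {c : ℝ} (hc : 0 < c)
    (h : ∀ᶠ j : ℕ in atTop, ‖D j‖ ≤ c * √(j : ℝ)) :
    ∀ᶠ J : ℕ in atTop, ‖∑ j ∈ Finset.range J, D j‖ ≤ 2 * c * (J * √(J : ℝ)) := by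
  obtain ⟨j₀, hj₀⟩ := eventually_atTop.mp h
  set B := ‖∑ j ∈ Finset.range j₀, D j‖ with hB
  filter_upwards [eventually_ge_atTop j₀, eventually_ge_atTop 1,
    tendsto_sqrt_natCast_atTop.eventually_ge_atTop (B / c)] with J hJ hJ1 hJB
  have hJ1' : (1 : ℝ) ≤ J := by exact_mod_cast hJ1
  rw [div_le_iff₀ hc] at hJB
  have h1 : ‖∑ j ∈ Finset.Ico j₀ J, D j‖ ≤ c * (J * √(J : ℝ)) := by
    have h2 : ∀ j ∈ Finset.Ico j₀ J, ‖D j‖ ≤ c * √(J : ℝ) := fun j hj => by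
      rw [Finset.mem_Ico] at hj
      refine (hj₀ j hj.1).trans (mul_le_mul_of_nonneg_left ?_ hc.le)
      exact Real.sqrt_le_sqrt (by exact_mod_cast hj.2.le)
    refine (norm_sum_le_of_le _ h2).trans ?_
    rw [Finset.sum_const, Nat.card_Ico, nsmul_eq_mul]
    have h3 : ((J - j₀ : ℕ) : ℝ) ≤ J := by exact_mod_cast Nat.sub_le _ _
    have h4 : 0 ≤ c * √(J : ℝ) := by positivity
    nlinarith
  rw [← Finset.sum_range_add_sum_Ico _ hJ]
  refine (norm_add_le _ _).trans ?_
  have h5 : √(J : ℝ) ≤ J * √(J : ℝ) := le_mul_of_one_le_left (Real.sqrt_nonneg _) hJ1'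
  have h6 := mul_le_mul_of_nonneg_left h5 hc.le
  linarith

theorem sqrt_pow_three (J : ℕ) : √(J : ℝ) ^ 3 = J * √(J : ℝ) := by
  rw [pow_succ, Real.sq_sqrt (Nat.cast_nonneg J)]

theorem tendsto_sum_sqrt_div :
    Tendsto (fun J : ℕ => (∑ j ∈ Finset.range J, √(j : ℝ)) / (J * √(J : ℝ))) atTop
      (𝓝 (2 / 3)) := by
  have hb : ∀ J : ℕ, 2 / 3 * (J * √(J : ℝ)) - √(J : ℝ) ≤ ∑ j ∈ Finset.range J, √(j : ℝ) ∧
      ∑ j ∈ Finset.range J, √(j : ℝ) ≤ 2 / 3 * (J * √(J : ℝ)) := by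
    intro J
    rw [← sqrt_pow_three]
    induction J with
    | zero => simp
    | succ J ih =>
      rw [Finset.sum_range_succ]
      have := sqrt_cube_sub_bounds J
      constructor <;> linarith [ih.1, ih.2]
  have hlow : Tendsto (fun J : ℕ => (2 / 3 : ℝ) - 1 / J) atTop (𝓝 (2 / 3)) := by
    simpa using tendsto_const_nhds.sub (tendsto_const_div_atTop_nhds_zero_nat (1 : ℝ))
  refine tendsto_of_tendsto_of_tendsto_of_le_of_le' hlow tendsto_const_nhds ?_ ?_
  · filter_upwards [eventually_ge_atTop 1] with J hJ
    have hJ' : (0 : ℝ) < J := by exact_mod_cast hJ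
    have hr : 0 < √(J : ℝ) := Real.sqrt_pos.mpr hJ'
    rw [le_div_iff₀ (by positivity)]
    refine le_trans (le_of_eq ?_) (hb J).1
    field_simp
  · filter_upwards [eventually_ge_atTop 1] with J hJ
    have hJ' : (0 : ℝ) < J := by exact_mod_cast hJ
    have hr : 0 < √(J : ℝ) := Real.sqrt_pos.mpr hJ'
    rw [div_le_iff₀ (by positivity)]
    exact (hb J).2

/-- Summation by parts: the partial sums are `o(j)` and the increments of `√j` are of order `1/√j`,
so the correction terms are `o(√j)`. -/
theorem tendsto_sum_sqrt_mul_zero {b : ℕ → ℂ} (hb : HasMean b 0) :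
    Tendsto (fun J : ℕ => (∑ j ∈ Finset.range J, (√(j : ℝ) : ℂ) * b j) / ((J * √(J : ℝ) : ℝ) : ℂ))
      atTop (𝓝 0) := by
  set A : ℕ → ℂ := fun n => ∑ j ∈ Finset.range n, b j with hA
  have hparts : ∀ J : ℕ, ∑ j ∈ Finset.range J, (√(j : ℝ) : ℂ) * b j
      = (√(J : ℝ) : ℂ) * A J
        - ∑ j ∈ Finset.range J, ((√((j + 1 : ℕ) : ℝ) - √(j : ℝ) : ℝ) : ℂ) * A (j + 1) := by
    intro J
    induction J with
    | zero => simp [hA]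
    | succ J ih =>
      have h1 : A (J + 1) = A J + b J := Finset.sum_range_succ _ _
      rw [Finset.sum_range_succ, Finset.sum_range_succ, ih, h1]
      push_cast
      ring
  rw [tendsto_zero_iff_norm_tendsto_zero, Metric.tendsto_atTop]
  intro ε' hε'
  -- The boundary term uses `ε` and the correction sum `4ε`; the sixth share makes the inequality
  -- strict.
  set ε := ε' / 6 with hε
  have hε0 : 0 < ε := by positivity
  have hAε : ∀ᶠ n : ℕ in atTop, ‖A n‖ ≤ ε * n := by
    have h1 := (tendsto_zero_iff_norm_tendsto_zero.mp hb).eventually (gt_mem_nhds hε0)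
    filter_upwards [h1, eventually_ge_atTop 1] with n hn hn1
    have hn' : (0 : ℝ) < n := by exact_mod_cast hn1
    rw [norm_div, Complex.norm_natCast, div_lt_iff₀ hn'] at hn
    exact hn.le
  have hD : ∀ᶠ j : ℕ in atTop, ‖((√((j + 1 : ℕ) : ℝ) - √(j : ℝ) : ℝ) : ℂ) * A (j + 1)‖
      ≤ (2 * ε) * √(j : ℝ) := by
    filter_upwards [(tendsto_add_atTop_nat 1).eventually hAε, eventually_ge_atTop 1] with j hj hj1
    have hj' : (1 : ℝ) ≤ j := by exact_mod_cast hj1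
    set u := √(j : ℝ) with hu
    set v := √((j + 1 : ℕ) : ℝ) with hv
    have hu2 : u ^ 2 = j := Real.sq_sqrt (Nat.cast_nonneg _)
    have hv2 : v ^ 2 = (j + 1 : ℕ) := Real.sq_sqrt (Nat.cast_nonneg _)
    have hv2' : v ^ 2 = u ^ 2 + 1 := by rw [hv2, hu2]; push_cast; ring
    have hu1 : 1 ≤ u := Real.one_le_sqrt.mpr hj'
    have hv0 : 0 ≤ v := Real.sqrt_nonneg _
    have huv : u ≤ v := Real.sqrt_le_sqrt (by push_cast; linarith)
    have hv2u : v ≤ 2 * u := by nlinarith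
    rw [norm_mul, Complex.norm_real, Real.norm_eq_abs, abs_of_nonneg (by linarith)]
    rw [← hv2] at hj
    have h1 : (v - u) * v ≤ 1 := by nlinarith
    calc (v - u) * ‖A (j + 1)‖ ≤ (v - u) * (ε * v ^ 2) :=
          mul_le_mul_of_nonneg_left hj (by linarith)
      _ = ((v - u) * v) * (ε * v) := by ring
      _ ≤ 1 * (ε * v) := mul_le_mul_of_nonneg_right h1 (by positivity)
      _ ≤ 2 * ε * u := by nlinarith
  have hDs := eventually_norm_sum_le_of_le_sqrt (by positivity) hD
  obtain ⟨J₀, hJ₀⟩ := eventually_atTop.mp (hAε.and (hDs.and (eventually_ge_atTop 1)))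
  refine ⟨J₀, fun J hJ => ?_⟩
  obtain ⟨h1, h2, h3⟩ := hJ₀ J hJ
  have hJ' : (0 : ℝ) < J := by exact_mod_cast h3
  have hr : 0 < √(J : ℝ) := Real.sqrt_pos.mpr hJ'
  rw [Real.dist_eq, sub_zero, abs_norm, norm_div, Complex.norm_real, Real.norm_eq_abs,
    abs_of_pos (by positivity), div_lt_iff₀ (by positivity), hparts]
  refine lt_of_le_of_lt (norm_sub_le _ _) ?_
  rw [norm_mul, Complex.norm_real, Real.norm_eq_abs, abs_of_pos hr]
  have h4 := mul_le_mul_of_nonneg_left h1 hr.le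
  have h5 : 0 < J * √(J : ℝ) := by positivity
  have h6 : √(J : ℝ) * (ε * J) = ε * (J * √(J : ℝ)) := by ring
  have h7 : ε' = 6 * ε := by rw [hε]; ring
  rw [h7]
  nlinarith

/-- Means with the weights `√j`. -/
theorem tendsto_sum_sqrt_mul {a : ℕ → ℂ} {μ : ℂ} (ha : HasMean a μ) :
    Tendsto (fun J : ℕ => (∑ j ∈ Finset.range J, (√(j : ℝ) : ℂ) * a j) / ((J * √(J : ℝ) : ℝ) : ℂ))
      atTop (𝓝 (2 / 3 * μ)) := by
  have h0 : HasMean (fun j => a j + -μ) 0 := by simpa using ha.add (HasMean.const (-μ))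
  have h1 := tendsto_sum_sqrt_mul_zero h0
  have h2 := ((Complex.continuous_ofReal.tendsto _).comp tendsto_sum_sqrt_div).mul_const μ
  have h3 := h1.add h2
  have e : (0 : ℂ) + ((2 / 3 : ℝ) : ℂ) * μ = 2 / 3 * μ := by push_cast; ring
  rw [e] at h3
  refine h3.congr fun J => ?_
  simp only [Function.comp_apply]
  push_cast
  rw [div_mul_eq_mul_div, ← add_div, Finset.sum_mul, ← Finset.sum_add_distrib]
  congr 1
  exact Finset.sum_congr rfl fun j _ => by ring

/-! ### Assembly of the windows into the `N^(3/4)` asymptotics -/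

theorem norm_sum_range_sub_sum_range_le {f : ℕ → ℂ} (hf : ∀ k, ‖f k‖ ≤ 1) {m n : ℕ} (h : m ≤ n) :
    ‖∑ k ∈ Finset.range n, f k - ∑ k ∈ Finset.range m, f k‖ ≤ (n : ℝ) - m := by
  rw [← Finset.sum_Ico_eq_sub _ h]
  refine (norm_sum_le_of_le _ fun k _ => hf k).trans ?_
  rw [Finset.sum_const, Nat.card_Ico, nsmul_eq_mul, mul_one, Nat.cast_sub h]

/-- On the scale of `√k` the stationary points are `2/(3s)` apart and each half-window takes at most
`1/(6s)`. The remaining `1/(3s)` separates the squares by at least 1, which makes room for the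
ceiling and the floor. -/
theorem windowHi_le_windowLo_succ {s κ : ℝ} (hs : 0 < s) (hκ : 0 < κ) {j : ℕ} (hj1 : 1 ≤ √(j : ℝ))
    (hj2 : 3 * s ≤ √(j : ℝ)) (hj3 : 6 * s * κ ≤ √(j : ℝ)) :
    windowHi s κ j ≤ windowLo s κ (j + 1) ∧
      0 ≤ 2 * (j + 1 : ℕ) / (3 * s) - κ / √(j + 1 : ℕ) := by
  set r := √(j : ℝ) with hr
  have hr0 : 0 < r := by linarith
  have hrj : r ^ 2 = j := Real.sq_sqrt (Nat.cast_nonneg _)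
  set p := 2 * (j : ℝ) / (3 * s) + κ / r with hp
  set q := 2 * ((j + 1 : ℕ) : ℝ) / (3 * s) - κ / √((j + 1 : ℕ) : ℝ) with hq
  have hw : 2 * (j : ℝ) / (3 * s) ≤ p := by rw [hp]; have : 0 < κ / r := by positivity
                                            linarith
  have hw0 : 0 ≤ 2 * (j : ℝ) / (3 * s) := by positivity
  have hqp : 1 / (3 * s) ≤ q - p := by
    have h1 : κ / √((j + 1 : ℕ) : ℝ) ≤ κ / r :=
      div_le_div_of_nonneg_left hκ.le hr0 (Real.sqrt_le_sqrt (by push_cast; linarith))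
    have h2 : κ / r ≤ 1 / (6 * s) := by
      rw [div_le_div_iff₀ hr0 (by positivity)]; linarith
    have h3 : 2 * ((j + 1 : ℕ) : ℝ) / (3 * s) = 2 * (j : ℝ) / (3 * s) + 4 * (1 / (6 * s)) := by
      push_cast; field_simp; ring
    have h4 : 1 / (3 * s) = 2 * (1 / (6 * s)) := by field_simp; norm_num
    rw [hq, hp, h3, h4]
    linarith
  have h3s : 0 < 1 / (3 * s) := by positivity
  refine ⟨?_, by linarith⟩
  have h1 : p ^ 2 + 1 ≤ q ^ 2 := by
    have h2 : 2 * (j : ℝ) / (3 * s) ≤ q + p := by linarith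
    have h3 : 1 ≤ 1 / (3 * s) * (2 * (j : ℝ) / (3 * s)) := by
      have e : 1 / (3 * s) * (2 * (j : ℝ) / (3 * s)) = 2 * r ^ 2 / (3 * s) ^ 2 := by
        rw [hrj]; field_simp
      rw [e, le_div_iff₀ (by positivity)]
      nlinarith
    have h4 : 1 / (3 * s) * (2 * (j : ℝ) / (3 * s)) ≤ (q - p) * (q + p) :=
      mul_le_mul hqp h2 hw0 (by linarith)
    linarith [show (q - p) * (q + p) = q ^ 2 - p ^ 2 by ring]
  exact Nat.le_floor ((Nat.ceil_lt_add_one (sq_nonneg _)).le.trans h1)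

/-- The error is not of lower order, but carries a factor `1/κ` that is made small afterwards. The
constant 5 is 4 from summing window and gap errors (2 per `j`, doubled by the early terms) and 1
from the last half-window. -/
theorem eventually_norm_sum_sub_truncated_le {s κ : ℝ} (hs : 0 < s) (hκ : 0 < κ) :
    ∀ᶠ J : ℕ in atTop,
      ‖∑ k ∈ Finset.range ⌊(2 * (J : ℝ) / (3 * s)) ^ 2⌋₊, unitExp (-(s * √(k : ℝ) ^ 3))
        - ((4 / (3 * s) : ℝ) * ∫ x in -κ..κ, unitExp (-x ^ 2)) *
          ∑ j ∈ Finset.range J, (√(j : ℝ) : ℂ) * unitExp (4 / (27 * s ^ 2) * (j : ℝ) ^ 3)‖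
      ≤ 5 / (s * κ) * (J * √(J : ℝ)) := by
  set S : ℕ → ℂ := fun N => ∑ k ∈ Finset.range N, unitExp (-(s * √(k : ℝ) ^ 3)) with hS
  set γ : ℂ := (4 / (3 * s) : ℝ) * ∫ x in -κ..κ, unitExp (-x ^ 2) with hγ
  set D : ℕ → ℂ := fun j => S (windowLo s κ (j + 1)) - S (windowLo s κ j)
    - γ * ((√(j : ℝ) : ℂ) * unitExp (4 / (27 * s ^ 2) * (j : ℝ) ^ 3)) with hD
  set C := 4 / (3 * s) * ((3 / 2 * s * (κ + 1)
        + 2 * Real.pi * (3 * s * (κ + 1) + s * (κ + 1) ^ 3)) * (2 * κ + 2) + 6 * s) with hC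
  have hge := fun R : ℝ => tendsto_sqrt_natCast_atTop.eventually_ge_atTop R
  have hDb : ∀ᶠ j : ℕ in atTop, ‖D j‖ ≤ (2 / (s * κ)) * √(j : ℝ) := by
    filter_upwards [hge 1, hge (3 * s), hge (3 * s * (κ + 1)), hge (6 * s * κ), hge (C * (s * κ)),
      eventually_ge_atTop 1] with j h1 h2 h3 h4 h5 hj
    obtain ⟨hle, hq⟩ := windowHi_le_windowLo_succ hs hκ h1 h2 h4
    have hwin := norm_sum_window_sub_le hs hκ rfl h1 h2 h3
    have hgap := norm_sum_gap_le hs hκ (j := j) hj hq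
    have hle' : windowLo s κ j ≤ windowHi s κ j := by
      refine (Nat.floor_mono ?_).trans (Nat.floor_le_ceil _)
      have hκr : 0 < κ / √(j : ℝ) := by positivity
      have h0 : 0 ≤ 2 * (j : ℝ) / (3 * s) := by positivity
      refine sq_le_sq' ?_ ?_ <;> linarith
    have hsplit : S (windowLo s κ (j + 1)) - S (windowLo s κ j)
        = (∑ k ∈ Finset.Ico (windowLo s κ j) (windowHi s κ j), unitExp (-(s * √(k : ℝ) ^ 3)))
          + ∑ k ∈ Finset.Ico (windowHi s κ j) (windowLo s κ (j + 1)),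
              unitExp (-(s * √(k : ℝ) ^ 3)) := by
      rw [Finset.sum_Ico_consecutive _ hle' hle, Finset.sum_Ico_eq_sub _ (hle'.trans hle)]
    have e : D j = ((∑ k ∈ Finset.Ico (windowLo s κ j) (windowHi s κ j),
          unitExp (-(s * √(k : ℝ) ^ 3))) - (√(j : ℝ) : ℂ) * γ
            * unitExp (4 / (27 * s ^ 2) * (j : ℝ) ^ 3))
        + ∑ k ∈ Finset.Ico (windowHi s κ j) (windowLo s κ (j + 1)),
            unitExp (-(s * √(k : ℝ) ^ 3)) := by
      simp only [hD]
      rw [hsplit]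
      ring
    rw [e]
    refine (norm_add_le _ _).trans ?_
    have hC' : C ≤ 1 / (s * κ) * √(j : ℝ) := by
      rw [one_div_mul_eq_div, le_div_iff₀ (by positivity)]
      exact h5
    have hj' : (1 : ℝ) ≤ j := by exact_mod_cast hj
    have hsq : √((j + 1 : ℕ) : ℝ) ≤ 3 / 2 * √(j : ℝ) := by
      rw [Real.sqrt_le_left (by positivity), mul_pow, Real.sq_sqrt (Nat.cast_nonneg _)]
      push_cast
      linarith
    have hgap' : 2 * √((j + 1 : ℕ) : ℝ) / (3 * s * κ) ≤ 1 / (s * κ) * √(j : ℝ) := by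
      rw [one_div_mul_eq_div, div_le_div_iff₀ (by positivity) (by positivity)]
      have : 0 < s * κ := by positivity
      nlinarith
    have e2 : 2 / (s * κ) * √(j : ℝ) = 1 / (s * κ) * √(j : ℝ) + 1 / (s * κ) * √(j : ℝ) := by ring
    rw [e2]
    exact add_le_add (hwin.trans hC') (hgap.trans hgap')
  have hDs := eventually_norm_sum_le_of_le_sqrt (by positivity) hDb
  filter_upwards [hDs, hge 1, hge (3 * s), hge (3 * s * κ), hge (s * κ * (4 * κ / (3 * s) + 1))]
    with J hJ h1 h2 h3 h4
  -- Division by `√0 = 0` gives 0, so the windows start at 0 and the telescoping sum has no lower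
  -- boundary term.
  have hlo0 : windowLo s κ 0 = 0 := by simp [windowLo]
  have htel : ∑ j ∈ Finset.range J, D j = S (windowLo s κ J)
      - γ * ∑ j ∈ Finset.range J, (√(j : ℝ) : ℂ) * unitExp (4 / (27 * s ^ 2) * (j : ℝ) ^ 3) := by
    simp only [hD]
    rw [Finset.sum_sub_distrib, Finset.sum_range_sub (fun j => S (windowLo s κ j)), hlo0,
      ← Finset.mul_sum]
    simp [hS]
  set r := √(J : ℝ) with hr
  have hr0 : 0 < r := by linarith
  have hrJ : r ^ 2 = J := Real.sq_sqrt (Nat.cast_nonneg _)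
  set w := 2 * (J : ℝ) / (3 * s) with hw
  have hwr : w = 2 * r ^ 2 / (3 * s) := by rw [hw, hrJ]
  have hκr : 0 < κ / r := by positivity
  have hκw : κ / r ≤ w := by
    rw [hwr, div_le_div_iff₀ hr0 (by positivity)]
    nlinarith [mul_pos hr0 hr0]
  have hle : windowLo s κ J ≤ ⌊w ^ 2⌋₊ := by
    refine Nat.floor_mono (pow_le_pow_left₀ ?_ ?_ 2) <;> linarith
  have hdiff : ‖S ⌊w ^ 2⌋₊ - S (windowLo s κ J)‖ ≤ 1 / (s * κ) * (J * r) := by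
    refine (norm_sum_range_sub_sum_range_le (fun k => (norm_unitExp _).le) hle).trans ?_
    have h5 : (⌊w ^ 2⌋₊ : ℝ) ≤ w ^ 2 := Nat.floor_le (sq_nonneg _)
    have h6 : (w - κ / r) ^ 2 < (windowLo s κ J : ℝ) + 1 := Nat.lt_floor_add_one _
    have h7 : w * (κ / r) = 2 * κ * r / (3 * s) := by rw [hwr]; field_simp
    have h8 : 4 * κ / (3 * s) * r + 1 ≤ 1 / (s * κ) * (r ^ 2 * r) := by
      rw [one_div_mul_eq_div, le_div_iff₀ (by positivity)]
      have h9 : (4 * κ / (3 * s) * r + 1) * (s * κ) ≤ r * r := by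
        have : (4 * κ / (3 * s) * r + 1) * (s * κ) ≤ r * (s * κ * (4 * κ / (3 * s) + 1)) := by
          have : 0 < s * κ := by positivity
          nlinarith
        nlinarith
      nlinarith
    have h10 : 4 * κ / (3 * s) * r = 2 * (2 * κ * r / (3 * s)) := by ring
    rw [← hrJ]
    nlinarith [sq_nonneg (κ / r)]
  have e : S ⌊w ^ 2⌋₊ - γ * ∑ j ∈ Finset.range J,
        (√(j : ℝ) : ℂ) * unitExp (4 / (27 * s ^ 2) * (j : ℝ) ^ 3)
      = (S ⌊w ^ 2⌋₊ - S (windowLo s κ J)) + ∑ j ∈ Finset.range J, D j := by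
    rw [htel]; ring
  rw [e]
  refine (norm_add_le _ _).trans ?_
  have e2 : 5 / (s * κ) * (J * r) = 1 / (s * κ) * (J * r) + 2 * (2 / (s * κ)) * (J * r) := by ring
  rw [e2]
  exact add_le_add hdiff hJ

theorem tendsto_sum_unitExp_sqrt_cube_floor {s : ℝ} (hs : 0 < s) {μ : ℂ}
    (hμ : HasMean (fun j => unitExp (4 / (27 * s ^ 2) * (j : ℝ) ^ 3)) μ) :
    Tendsto (fun J : ℕ =>
      (∑ k ∈ Finset.range ⌊(2 * (J : ℝ) / (3 * s)) ^ 2⌋₊, unitExp (-(s * √(k : ℝ) ^ 3))) /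
        ((J * √(J : ℝ) : ℝ) : ℂ)) atTop
      (𝓝 ((4 / (3 * s) : ℝ) * (1 / (2 * Complex.I)) ^ (1 / 2 : ℂ) * (2 / 3 * μ))) := by
  set V : ℕ → ℂ := fun J =>
    ∑ k ∈ Finset.range ⌊(2 * (J : ℝ) / (3 * s)) ^ 2⌋₊, unitExp (-(s * √(k : ℝ) ^ 3)) with hV
  set T : ℕ → ℂ := fun J =>
    ∑ j ∈ Finset.range J, (√(j : ℝ) : ℂ) * unitExp (4 / (27 * s ^ 2) * (j : ℝ) ^ 3) with hT
  set γ : ℂ := (4 / (3 * s) : ℝ) * (1 / (2 * Complex.I)) ^ (1 / 2 : ℂ) with hγ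
  have hTb : ∀ J : ℕ, ‖T J‖ ≤ J * √(J : ℝ) := by
    intro J
    have h2 : ∀ j ∈ Finset.range J,
        ‖(√(j : ℝ) : ℂ) * unitExp (4 / (27 * s ^ 2) * (j : ℝ) ^ 3)‖ ≤ √(J : ℝ) := fun j hj => by
      rw [norm_mul, norm_unitExp, mul_one, Complex.norm_real, Real.norm_eq_abs,
        abs_of_nonneg (Real.sqrt_nonneg _)]
      exact Real.sqrt_le_sqrt (by exact_mod_cast (Finset.mem_range.mp hj).le)
    refine (norm_sum_le_of_le _ h2).trans (le_of_eq ?_)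
    simp
  have hzero : Tendsto (fun J : ℕ => (V J - γ * T J) / ((J * √(J : ℝ) : ℝ) : ℂ)) atTop (𝓝 0) := by
    rw [tendsto_zero_iff_norm_tendsto_zero, Metric.tendsto_atTop]
    intro ε hε
    -- Of the nine shares, 5 pay for the truncated estimate, 3 for completing the Fresnel integral
    -- (`8/3 ≤ 3`), and 1 gives strictness.
    set κ : ℝ := 9 / (s * ε) with hκ
    have hκ0 : 0 < κ := by positivity
    set γκ : ℂ := (4 / (3 * s) : ℝ) * ∫ x in -κ..κ, unitExp (-x ^ 2) with hγκ
    have hγd : ‖γκ - γ‖ ≤ 3 / (s * κ) := by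
      rw [norm_sub_rev, hγ, hγκ, ← mul_sub, norm_mul, Complex.norm_real, Real.norm_eq_abs,
        abs_of_pos (by positivity)]
      refine (mul_le_mul_of_nonneg_left (norm_fresnel_sub_integral_le hκ0) (by positivity)).trans ?_
      rw [div_mul_div_comm, div_le_div_iff₀ (by positivity) (by positivity)]
      have : 0 < s * κ := by positivity
      nlinarith
    obtain ⟨J₀, hJ₀⟩ := eventually_atTop.mp
      ((eventually_norm_sum_sub_truncated_le hs hκ0).and (eventually_ge_atTop 1))
    refine ⟨J₀, fun J hJ => ?_⟩
    obtain ⟨h1, h2⟩ := hJ₀ J hJ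
    have hJ' : (0 : ℝ) < J := by exact_mod_cast h2
    have hr : 0 < √(J : ℝ) := Real.sqrt_pos.mpr hJ'
    rw [Real.dist_eq, sub_zero, abs_norm, norm_div, Complex.norm_real, Real.norm_eq_abs,
      abs_of_pos (by positivity), div_lt_iff₀ (by positivity)]
    have e : V J - γ * T J = (V J - γκ * T J) + (γκ - γ) * T J := by ring
    rw [e]
    refine lt_of_le_of_lt (norm_add_le _ _) ?_
    rw [norm_mul]
    have h3 := mul_le_mul hγd (hTb J) (norm_nonneg _) (by positivity)
    have h4 : ε = 9 / (s * κ) := by rw [hκ]; field_simp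
    have h5 : 0 < 1 / (s * κ) * (J * √(J : ℝ)) := by positivity
    have h6 : ε * (J * √(J : ℝ)) = 5 / (s * κ) * (J * √(J : ℝ)) + 3 / (s * κ) * (J * √(J : ℝ))
        + 1 / (s * κ) * (J * √(J : ℝ)) := by rw [h4]; ring
    rw [h6]
    linarith
  have h1 := hzero.add ((tendsto_sum_sqrt_mul hμ).const_mul γ)
  rw [zero_add] at h1
  refine h1.congr fun J => ?_
  change (V J - γ * T J) / _ + γ * (T J / _) = V J / _
  ring

/-- The exponential sums `∑_{k < N} exp (-2 π i s k ^ (3 / 2))` are asymptotic to a multiple of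
`N ^ (3 / 4)`. -/
theorem tendsto_sum_unitExp_sqrt_cube {s : ℝ} (hs : 0 < s) {μ : ℂ}
    (hμ : HasMean (fun j => unitExp (4 / (27 * s ^ 2) * (j : ℝ) ^ 3)) μ) :
    Tendsto (fun N : ℕ => (∑ k ∈ Finset.range N, unitExp (-(s * √(k : ℝ) ^ 3))) /
        (((N : ℝ) ^ (3 / 4 : ℝ) : ℝ) : ℂ)) atTop
      (𝓝 (((4 / (3 * s) : ℝ) * (1 / (2 * Complex.I)) ^ (1 / 2 : ℂ) * (2 / 3 * μ)) *
        ((3 / 2 * s * √(3 / 2 * s) : ℝ) : ℂ))) := by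
  set S : ℕ → ℂ := fun N => ∑ k ∈ Finset.range N, unitExp (-(s * √(k : ℝ) ^ 3)) with hS
  -- The largest `j` whose stationary point `2j/(3s)` does not exceed `√N`.
  set J : ℕ → ℕ := fun N => ⌊3 / 2 * s * √(N : ℝ)⌋₊ with hJ
  have hJtop : Tendsto J atTop atTop :=
    tendsto_nat_floor_atTop.comp (tendsto_sqrt_natCast_atTop.const_mul_atTop (by positivity))
  have hpow : ∀ N : ℕ, (N : ℝ) ^ (3 / 4 : ℝ) = √(N : ℝ) * √√(N : ℝ) := by
    intro N
    have hN : (0 : ℝ) ≤ N := Nat.cast_nonneg N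
    rw [Real.sqrt_eq_rpow, Real.sqrt_eq_rpow, ← Real.rpow_mul hN, ← Real.rpow_add_of_nonneg hN]
      <;> norm_num
  have hJdiv : Tendsto (fun N : ℕ => (J N : ℝ) / √(N : ℝ)) atTop (𝓝 (3 / 2 * s)) :=
    (tendsto_nat_floor_mul_div_atTop (by positivity)).comp tendsto_sqrt_natCast_atTop
  have hscale : Tendsto (fun N : ℕ => ((J N * √(J N : ℝ) : ℝ)) / (N : ℝ) ^ (3 / 4 : ℝ)) atTop
      (𝓝 (3 / 2 * s * √(3 / 2 * s))) := by
    have h1 := hJdiv.mul ((Real.continuous_sqrt.tendsto _).comp hJdiv)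
    refine h1.congr fun N => ?_
    rw [Function.comp_apply, hpow, Real.sqrt_div (Nat.cast_nonneg _), div_mul_div_comm]
  have hmain := ((tendsto_sum_unitExp_sqrt_cube_floor hs hμ).comp hJtop).mul
    ((Complex.continuous_ofReal.tendsto _).comp hscale)
  set M : ℕ → ℕ := fun N => ⌊(2 * (J N : ℝ) / (3 * s)) ^ 2⌋₊ with hM
  -- Between the last stationary point and `N` there are only `O(√N)` indices, fewer in order than
  -- `N^(3/4)`.
  have herr : Tendsto (fun N : ℕ => (S N - S (M N)) / (((N : ℝ) ^ (3 / 4 : ℝ) : ℝ) : ℂ)) atTop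
      (𝓝 0) := by
    set c := 4 / (3 * s) + 4 / (9 * s ^ 2) + 1 with hc
    have hlim : Tendsto (fun N : ℕ => c / √√(N : ℝ)) atTop (𝓝 0) :=
      (Real.tendsto_sqrt_atTop.comp tendsto_sqrt_natCast_atTop).const_div_atTop c
    refine squeeze_zero_norm' ?_ hlim
    filter_upwards [eventually_ge_atTop 1] with N hN
    have hN' : (1 : ℝ) ≤ N := by exact_mod_cast hN
    have hr1 : 1 ≤ √(N : ℝ) := Real.one_le_sqrt.mpr hN'
    have hrr : 0 < √√(N : ℝ) := Real.sqrt_pos.mpr (by linarith)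
    set r := √(N : ℝ) with hr
    have hrN : r ^ 2 = N := Real.sq_sqrt (Nat.cast_nonneg _)
    have hJ1 : (J N : ℝ) ≤ 3 / 2 * s * r := Nat.floor_le (by positivity)
    have hJ2 : 3 / 2 * s * r < (J N : ℝ) + 1 := Nat.lt_floor_add_one _
    have hw1 : 2 * (J N : ℝ) / (3 * s) ≤ r := by
      rw [div_le_iff₀ (by positivity)]; linarith
    have hw2 : r ≤ 2 * (J N : ℝ) / (3 * s) + 2 / (3 * s) := by
      rw [← add_div, le_div_iff₀ (by positivity)]; linarith
    set w := 2 * (J N : ℝ) / (3 * s) with hw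
    have hw0 : 0 ≤ w := by positivity
    have hMN : M N ≤ N := by
      have h1 : w ^ 2 ≤ N := by rw [← hrN]; exact pow_le_pow_left₀ hw0 hw1 2
      exact Nat.floor_le_of_le h1
    rw [norm_div, Complex.norm_real, Real.norm_eq_abs, hpow, abs_of_pos (by positivity),
      ← div_div]
    refine div_le_div_of_nonneg_right ?_ hrr.le
    rw [div_le_iff₀ (by linarith)]
    refine (norm_sum_range_sub_sum_range_le (fun k => (norm_unitExp _).le) hMN).trans ?_
    have h2 : w ^ 2 < (M N : ℝ) + 1 := Nat.lt_floor_add_one _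
    have h3 : (N : ℝ) ≤ (w + 2 / (3 * s)) ^ 2 := by
      rw [← hrN]; exact pow_le_pow_left₀ (by linarith) hw2 2
    have h4 : (w + 2 / (3 * s)) ^ 2 = w ^ 2 + 4 / (3 * s) * w + 4 / (9 * s ^ 2) := by
      field_simp; ring
    have h5 : 4 / (3 * s) * w ≤ 4 / (3 * s) * r := mul_le_mul_of_nonneg_left hw1 (by positivity)
    have h6 : 4 / (9 * s ^ 2) ≤ 4 / (9 * s ^ 2) * r := le_mul_of_one_le_right (by positivity) hr1
    have h7 : c * r = 4 / (3 * s) * r + 4 / (9 * s ^ 2) * r + r := by rw [hc]; ring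
    rw [h7]
    linarith
  have htot := herr.add hmain
  rw [zero_add] at htot
  refine htot.congr' ?_
  filter_upwards [hJtop.eventually_ge_atTop 1] with N hN
  have hN' : (0 : ℝ) < J N := by exact_mod_cast hN
  have hJne : ((J N * √(J N : ℝ) : ℝ) : ℂ) ≠ 0 :=
    Complex.ofReal_ne_zero.mpr (by have := Real.sqrt_pos.mpr hN'; positivity)
  change (S N - S (M N)) / _ + S (M N) / ((J N * √(J N : ℝ) : ℝ) : ℂ) *
    (((J N * √(J N : ℝ) : ℝ) / (N : ℝ) ^ (3 / 4 : ℝ) : ℝ) : ℂ) = S N / _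
  rw [Complex.ofReal_div, div_mul_div_cancel₀ hJne, sub_div, sub_add_cancel]

/-! ### Cubic means and the two profiles -/

/-- A positive factor does not change the argument, so the principal root is multiplicative here. -/
theorem cpow_half_ofReal_mul {a : ℝ} (ha : 0 < a) (z : ℂ) (hz : z ≠ 0) :
    ((a : ℂ) * z) ^ (1 / 2 : ℂ) = (√a : ℂ) * z ^ (1 / 2 : ℂ) := by
  have ha' : (a : ℂ) ≠ 0 := Complex.ofReal_ne_zero.mpr ha.ne'
  rw [Complex.cpow_def_of_ne_zero (mul_ne_zero ha' hz), Complex.cpow_def_of_ne_zero hz,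
    Complex.log_ofReal_mul ha hz, add_mul, Complex.exp_add, Complex.ofReal_log ha.le,
    Real.sqrt_eq_rpow, Complex.ofReal_cpow ha.le, Complex.cpow_def_of_ne_zero ha']
  norm_num

theorem unitExp_mul_pow_add {t : ℝ} {n : ℕ} {p : ℤ} (h : t * n = p) (b k : ℕ) :
    unitExp (t * ((k + n : ℕ) : ℝ) ^ b) = unitExp (t * (k : ℝ) ^ b) := by
  obtain ⟨c, hc⟩ : (n : ℤ) ∣ ((k + n : ℕ) : ℤ) ^ b - (k : ℤ) ^ b := by
    have := sub_dvd_pow_sub_pow ((k + n : ℕ) : ℤ) (k : ℤ) b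
    rwa [Nat.cast_add, add_sub_cancel_left, ← Nat.cast_add] at this
  have hc' : ((k + n : ℕ) : ℝ) ^ b = (k : ℝ) ^ b + n * c := by
    have : (((k + n : ℕ) : ℤ) ^ b : ℝ) - ((k : ℤ) ^ b : ℝ) = ((n : ℤ) : ℝ) * c := by
      exact_mod_cast hc
    push_cast at this ⊢
    linarith
  rw [hc', mul_add, ← mul_assoc, h, unitExp_add, ← Int.cast_mul, unitExp_intCast, mul_one]

theorem periodic_unitExp_mul_pow {t : ℝ} {n : ℕ} {p : ℤ} (h : t * n = p) (b : ℕ) :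
    Function.Periodic (fun k : ℕ => unitExp (t * (k : ℝ) ^ b)) n := fun k =>
  unitExp_mul_pow_add h b k

theorem hasMean_expMean (b m : ℕ) {n : ℕ} (hn : 1 ≤ n) :
    HasMean (fun k => unitExp (-((m : ℝ) / n * (k : ℝ) ^ b))) (expMean b m n) := by
  have hn' : (n : ℝ) ≠ 0 := by positivity
  have ht : -((m : ℝ) / n) * n = ((-m : ℤ) : ℝ) := by push_cast; field_simp
  have hper := periodic_unitExp_mul_pow ht b
  have hmean := HasMean.of_periodic (by omega) hper
  set a : ℕ → ℂ := fun k => unitExp (-((m : ℝ) / n) * (k : ℝ) ^ b) with ha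
  have hsum : ∑ l ∈ Finset.Icc 1 n, a l = ∑ k ∈ Finset.range n, a k := by
    have h1 : Finset.Icc 1 n = Finset.Ico 1 (n + 1) := by ext; simp
    have h2 : a n = a 0 := by simpa using hper 0
    rw [h1, Finset.sum_Ico_eq_sub _ (by omega), Finset.sum_range_succ, Finset.sum_range_one, h2]
    ring
  have e : expMean b m n = (∑ k ∈ Finset.range n, a k) / n := by
    rw [← hsum, expMean, one_div_mul_eq_div]
    congr 1
    refine Finset.sum_congr rfl fun l _ => ?_
    simp only [ha, unitExp]
    congr 1
    push_cast
    ring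
  rw [e]
  refine hmean.congr fun N => ?_
  simp only [ha, neg_mul]

/-- The means of `exp (2 π i t j ^ 3)` exist and are real. -/
theorem exists_hasMean_cube (t : ℝ) : ∃ μ : ℝ, HasMean (fun j => unitExp (t * (j : ℝ) ^ 3)) μ := by
  by_cases ht : Irrational t
  · exact ⟨0, by simpa using hasMean_unitExp_pow ht (by norm_num : 1 ≤ 3)⟩
  · obtain ⟨q, rfl⟩ : ∃ q : ℚ, (q : ℝ) = t := by simpa [Irrational] using ht
    set n := q.den with hn
    have hqn : (q : ℝ) * n = (q.num : ℤ) := by exact_mod_cast q.mul_den_eq_num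
    have hmean := HasMean.of_periodic q.den_pos (periodic_unitExp_mul_pow hqn 3)
    set a : ℕ → ℂ := fun k => unitExp ((q : ℝ) * (k : ℝ) ^ 3) with ha
    set P := ∑ k ∈ Finset.range n, a k with hP
    -- Cubing is odd, so `k ↦ n - k` conjugates the terms modulo the period; the sum over a period
    -- is its own conjugate.
    have hreflect : ∀ k ≤ n, a (n - k) = starRingEnd ℂ (a k) := by
      intro k hk
      simp only [ha]
      rw [← unitExp_neg, Nat.cast_sub hk]
      have e : (q : ℝ) * ((n : ℝ) - k) ^ 3
          = -((q : ℝ) * (k : ℝ) ^ 3) + ((q.num * (n ^ 2 - 3 * n * k + 3 * k ^ 2) : ℤ) : ℝ) := by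
        push_cast
        rw [← hqn]
        ring
      rw [e, unitExp_add, unitExp_intCast, mul_one]
    have han : a n = 1 := by
      have := hreflect 0 (Nat.zero_le _)
      simpa [ha] using this
    have hflip := Finset.sum_flip a (n := n)
    rw [Finset.sum_congr rfl (g := fun k => starRingEnd ℂ (a k))
      (fun k hk => hreflect k (Nat.lt_succ_iff.mp (Finset.mem_range.mp hk))), ← map_sum,
      Finset.sum_range_succ, han, map_add, map_one, add_left_inj] at hflip
    obtain ⟨r, hr⟩ := Complex.conj_eq_iff_real.mp hflip
    refine ⟨r / n, ?_⟩
    rw [Complex.ofReal_div, ← hr]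
    exact hmean

/-- Reality of the mean reconciles the signs: stationary phase produces `exp(+2πi t j³)`, while the
profile for `b = 3` involves `exp(-2πi t j³)`. -/
theorem HasMean.cube_neg {t μ : ℝ} (h : HasMean (fun j => unitExp (t * (j : ℝ) ^ 3)) μ) :
    HasMean (fun j => unitExp (-(t * (j : ℝ) ^ 3))) μ := by
  have := h.conj
  rw [Complex.conj_ofReal] at this
  simpa only [unitExp_neg] using this

theorem HasProfile.unique {b d s : ℝ} {L L' : ℂ} (h : HasProfile b d s L)
    (h' : HasProfile b d s L') : L = L' :=
  tendsto_nhds_unique h h'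

theorem hasProfile_three_of_hasMean {t μ : ℝ}
    (h : HasMean (fun j => unitExp (t * (j : ℝ) ^ 3)) μ) :
    HasProfile 3 3 t (μ * Real.Gamma (4 / 3)) := by
  have := hasProfile_of_hasMean (b := 3) (s := t) (c := μ) (by norm_num)
    (by simpa only [Real.rpow_ofNat] using h.cube_neg)
  norm_num at this ⊢
  exact this

theorem hasProfile_three_halves_of_pos {s μ : ℝ} (hs : 0 < s)
    (h : HasMean (fun j => unitExp (4 / 27 * (s ^ 2)⁻¹ * (j : ℝ) ^ 3)) μ) :
    HasProfile (3 / 2) 2 s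
      (((Real.pi : ℂ) * (s : ℂ) / (3 * Complex.I)) ^ (1 / 2 : ℂ) * μ) := by
  have ht : 4 / 27 * (s ^ 2)⁻¹ = 4 / (27 * s ^ 2) := by field_simp
  rw [ht] at h
  have h1 := tendsto_sum_unitExp_sqrt_cube hs h
  have hpow : ∀ k : ℕ, √(k : ℝ) ^ 3 = (k : ℝ) ^ (3 / 2 : ℝ) := by
    intro k
    rw [Real.sqrt_eq_rpow, ← Real.rpow_natCast, ← Real.rpow_mul (Nat.cast_nonneg k)]
    norm_num
  simp only [hpow] at h1
  have h2 := hasProfile_of_tendsto (b := 3 / 2) (d := 2) (by norm_num) (by norm_num) (by norm_num)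
    (by norm_num) h1
  convert h2 using 1
  have hΓ : Real.Gamma (1 + 1 / 2) = √Real.pi / 2 := by
    rw [add_comm, Real.Gamma_add_one (by norm_num), Real.Gamma_one_half_eq]
    ring
  have e1 : (Real.pi : ℂ) * (s : ℂ) / (3 * Complex.I)
      = ((2 / 3 * Real.pi * s : ℝ) : ℂ) * (1 / (2 * Complex.I)) := by
    push_cast
    field_simp
  have hpi := Real.pi_pos
  -- The constants combine as `4/(3s) · 2/3 · (3s/2)^(3/2) · Γ(3/2) = √(2πs/3)`; the root of
  -- `1/(2i)` is kept apart.
  have e2 : √(2 / 3 * Real.pi * s) = 4 / 3 * √(3 / 2 * s) * (√Real.pi / 2) := by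
    rw [Real.sqrt_eq_iff_mul_self_eq (by positivity) (by positivity)]
    have h3 := Real.mul_self_sqrt (show 0 ≤ 3 / 2 * s by positivity)
    have h4 := Real.mul_self_sqrt hpi.le
    linear_combination (-4 / 9 * √Real.pi * √Real.pi) * h3 - (2 / 3 * s) * h4
  have hsC : (s : ℂ) ≠ 0 := Complex.ofReal_ne_zero.mpr hs.ne'
  rw [e1, cpow_half_ofReal_mul (by positivity) _ (by simp), e2, hΓ]
  push_cast
  field_simp

theorem hasProfile_three_halves_of_hasMean {s μ : ℝ} (hs : s ≠ 0)
    (h : HasMean (fun j => unitExp (4 / 27 * (s ^ 2)⁻¹ * (j : ℝ) ^ 3)) μ) :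
    HasProfile (3 / 2) 2 s
      (((Real.pi : ℂ) * (s : ℂ) / (3 * Complex.I)) ^ (1 / 2 : ℂ) * μ) := by
  rcases lt_or_gt_of_ne hs with hneg | hpos
  · have h1 := (hasProfile_three_halves_of_pos (s := -s) (by linarith) (by simpa using h)).neg
    rw [neg_neg, map_mul, Complex.conj_ofReal] at h1
    convert h1 using 2
    -- The radicand is purely imaginary, so it avoids the branch cut and conjugation commutes with
    -- the root.
    have e : (Real.pi : ℂ) * ((-s : ℝ) : ℂ) / (3 * Complex.I)
        = ((-(Real.pi * (-s) / 3) : ℝ) : ℂ) * Complex.I := by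
      push_cast
      field_simp
      rw [Complex.I_sq]
      ring
    have hc : -(Real.pi * (-s) / 3) < 0 := by
      have := mul_pos Real.pi_pos (neg_pos.mpr hneg)
      linarith
    have harg : ((Real.pi : ℂ) * ((-s : ℝ) : ℂ) / (3 * Complex.I)).arg ≠ Real.pi := by
      rw [e, Ne, Complex.arg_eq_pi_iff]
      simp
    have h2 := Complex.conj_cpow ((Real.pi : ℂ) * ((-s : ℝ) : ℂ) / (3 * Complex.I)) (1 / 2 : ℂ) harg
    have h3 : starRingEnd ℂ (1 / 2 : ℂ) = 1 / 2 := by simp [map_ofNat]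
    rw [h3] at h2
    rw [← h2]
    congr 1
    rw [map_div₀, map_mul, map_mul, Complex.conj_I, Complex.conj_ofReal, Complex.conj_ofReal,
      map_ofNat]
    push_cast
    field_simp
  · exact hasProfile_three_halves_of_pos hpos h

/-! ### Growth bounds and the final theorem -/

theorem HasProfile.isBigO {b d s : ℝ} {L : ℂ} (h : HasProfile b d s L) :
    (fun x : ℝ => powerDirichlet b ((x : ℂ) + 2 * (Real.pi : ℂ) * Complex.I * (s : ℂ)))
      =O[𝓝[>] (0 : ℝ)] (fun x : ℝ => x ^ (-(1 / d))) := by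
  refine IsBigO.of_bound (‖L‖ + 1) ?_
  have h1 : Tendsto _ _ _ := Tendsto.norm h
  filter_upwards [h1.eventually (gt_mem_nhds (lt_add_one ‖L‖)), self_mem_nhdsWithin] with x hx hx0
  have hx0' : (0 : ℝ) < x := hx0
  have hp : 0 < x ^ (1 / d) := Real.rpow_pos_of_pos hx0' _
  rw [norm_mul, Complex.norm_real, Real.norm_eq_abs, abs_of_pos hp] at hx
  rw [Real.rpow_neg hx0'.le, norm_inv, Real.norm_eq_abs, abs_of_pos hp, ← div_eq_mul_inv,
    le_div_iff₀ hp, mul_comm]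
  exact hx.le

theorem hasProfile_zero {b : ℝ} (hb : 1 ≤ b) :
    Tendsto (fun x : ℝ => ((x ^ (1 / b) : ℝ) : ℂ) * powerDirichlet b (x : ℂ)) (𝓝[>] 0)
      (𝓝 (Real.Gamma (1 + 1 / b) : ℂ)) := by
  have h := hasProfile_of_hasMean hb (s := 0) (c := 1)
    (by simpa using HasMean.const (1 : ℂ))
  simpa [HasProfile] using h

theorem exists_forall_rpow_mul_norm_powerDirichlet_lt {b : ℝ} (hb : 1 ≤ b) :
    ∃ M : ℝ, ∀ᶠ x : ℝ in 𝓝[>] 0, ∀ y : ℝ,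
      x ^ (1 / b) * ‖powerDirichlet b ((x : ℂ) + Complex.I * (y : ℂ))‖ < M := by
  have h := (hasProfile_zero hb).norm
  refine ⟨‖(Real.Gamma (1 + 1 / b) : ℂ)‖ + 1, ?_⟩
  filter_upwards [h.eventually (gt_mem_nhds (lt_add_one _)), self_mem_nhdsWithin] with x hx hx0 y
  have hx0' : (0 : ℝ) < x := hx0
  have hp : 0 < x ^ (1 / b) := Real.rpow_pos_of_pos hx0' _
  rw [norm_mul, Complex.norm_real, Real.norm_eq_abs, abs_of_pos hp] at hx
  exact (mul_le_mul_of_nonneg_left (norm_powerDirichlet_le hb hx0' y) hp.le).trans_lt hx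

theorem ae_irrational : ∀ᵐ s : ℝ, Irrational s :=
  (Set.countable_range ((↑) : ℚ → ℝ)).ae_notMem volume

theorem hasProfile_natCast_of_hasMean {b : ℕ} (hb : 1 ≤ b) {s : ℝ} {c : ℂ}
    (h : HasMean (fun k => unitExp (-(s * (k : ℝ) ^ b))) c) :
    HasProfile b b s (c * Real.Gamma (1 + 1 / (b : ℝ))) :=
  hasProfile_of_hasMean (by exact_mod_cast hb) (by simpa only [Real.rpow_natCast] using h)

theorem theorem5 :
    -- (i) the case `g(j) = j ^ b` with `b` a positive integer
    (∀ b : ℕ, 1 ≤ b →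
      (∃ M : ℝ, ∀ᶠ x : ℝ in 𝓝[>] 0, ∀ y : ℝ,
        x ^ (1 / (b : ℝ)) * ‖powerDirichlet b ((x : ℂ) + Complex.I * (y : ℂ))‖ < M) ∧
      (∀ m n : ℕ, 1 ≤ n → Nat.Coprime m n →
        HasProfile b b ((m : ℝ) / (n : ℝ))
          ((Real.Gamma (1 + 1 / (b : ℝ)) : ℂ) * expMean b m n)) ∧
      (∀ᵐ s : ℝ, HasProfile b b s 0)) ∧
    -- (ii) the case `g(j) = j ^ (3 / 2)`: growth at `0` and elsewhere on the imaginary line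
    Tendsto (fun x : ℝ => ((x ^ (2 / 3 : ℝ) : ℝ) : ℂ) * powerDirichlet (3 / 2) (x : ℂ))
      (𝓝[>] 0) (𝓝 (Real.Gamma (5 / 3) : ℂ)) ∧
    (∀ y : ℝ, y ≠ 0 →
      (fun x : ℝ => powerDirichlet (3 / 2) ((x : ℂ) + Complex.I * (y : ℂ)))
        =O[𝓝[>] (0 : ℝ)] (fun x : ℝ => x ^ (-(1 / 2) : ℝ))) ∧
    -- the profile of `g(j) = j ^ (3 / 2)`
    (∀ m n : ℕ, 1 ≤ m → 1 ≤ n → Nat.Coprime m n → ∀ s : ℝ,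
      s = 4 / 27 * ((n : ℝ) / (m : ℝ)) →
        HasProfile (3 / 2) 2 (Real.sqrt s)
          (((Real.pi : ℂ) / (3 * Complex.I)) ^ (1 / 2 : ℂ) * ((s ^ (1 / 4 : ℝ) : ℝ) : ℂ) *
            expMean 3 m n)) ∧
    (∀ᵐ s : ℝ, 0 < s → HasProfile (3 / 2) 2 (Real.sqrt s) 0) ∧
    -- the duality relation: if one of the two limits exists, so does the other
    (∀ s : ℝ, s ≠ 0 → ∀ L : ℂ,
      HasProfile 3 3 (4 / 27 * (s ^ 2)⁻¹) L ↔
        HasProfile (3 / 2) 2 s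
          (((Real.pi : ℂ) * (s : ℂ) / (3 * Complex.I)) ^ (1 / 2 : ℂ) /
            (Real.Gamma (4 / 3) : ℂ) * L)) := by
  refine ⟨fun b hb => ⟨?_, ?_, ?_⟩, ?_, ?_, ?_, ?_, ?_⟩
  · exact exists_forall_rpow_mul_norm_powerDirichlet_lt (by exact_mod_cast hb)
  · intro m n hn _
    rw [mul_comm]
    exact hasProfile_natCast_of_hasMean hb (hasMean_expMean b m hn)
  · filter_upwards [ae_irrational] with s hs
    have h := hasProfile_natCast_of_hasMean hb (s := s) (c := 0)
      (by simpa only [neg_mul] using hasMean_unitExp_pow hs.neg hb)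
    simpa using h
  · have h := hasProfile_zero (b := 3 / 2) (by norm_num)
    norm_num at h ⊢
    exact h
  · intro y hy
    have hs : y / (2 * Real.pi) ≠ 0 := div_ne_zero hy Real.two_pi_pos.ne'
    -- The cubic mean exists at every real argument, so the profile exists at every nonzero point; a
    -- convergent profile gives the growth bound.
    obtain ⟨μ, hμ⟩ := exists_hasMean_cube (4 / 27 * ((y / (2 * Real.pi)) ^ 2)⁻¹)
    refine (hasProfile_three_halves_of_hasMean hs hμ).isBigO.congr_left fun x => ?_
    congr 2
    have hpi : (Real.pi : ℂ) ≠ 0 := Complex.ofReal_ne_zero.mpr Real.pi_ne_zero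
    push_cast
    field_simp
  · intro m n hm hn _ s hs
    have hs0 : 0 < s := by rw [hs]; positivity
    have hr : 0 < √s := Real.sqrt_pos.mpr hs0
    have ht : 4 / 27 * ((√s) ^ 2)⁻¹ = (m : ℝ) / n := by
      have hm' : (m : ℝ) ≠ 0 := by positivity
      have hn' : (n : ℝ) ≠ 0 := by positivity
      rw [Real.sq_sqrt hs0.le, hs]
      field_simp
    obtain ⟨μ, hμ⟩ := exists_hasMean_cube (4 / 27 * ((√s) ^ 2)⁻¹)
    have h1 := hasProfile_three_halves_of_hasMean hr.ne' hμ
    rw [ht] at hμ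
    -- The mean over a period and the real mean `μ` belong to phases of opposite sign; they agree
    -- because `μ` is real.
    have hmean : expMean 3 m n = μ :=
      tendsto_nhds_unique (hasMean_expMean 3 m hn) hμ.cube_neg
    convert h1 using 1
    have e : (Real.pi : ℂ) * (√s : ℂ) / (3 * Complex.I)
        = (√s : ℂ) * ((Real.pi : ℂ) / (3 * Complex.I)) := by ring
    have e2 : s ^ (1 / 4 : ℝ) = √√s := by
      rw [Real.sqrt_eq_rpow, Real.sqrt_eq_rpow, ← Real.rpow_mul hs0.le]
      norm_num
    rw [e, cpow_half_ofReal_mul hr _ (by simp [Real.pi_ne_zero]), hmean, e2]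
    ring
  · filter_upwards [ae_irrational] with s hs hs0
    have hirr : Irrational (4 / 27 * ((√s) ^ 2)⁻¹) := by
      rw [Real.sq_sqrt hs0.le]
      have := hs.inv.ratCast_mul (q := 4 / 27) (by norm_num)
      push_cast at this
      exact this
    have h := hasProfile_three_halves_of_hasMean (μ := 0) (Real.sqrt_pos.mpr hs0).ne'
      (by simpa using hasMean_unitExp_pow hirr (by norm_num : 1 ≤ 3))
    simpa using h
  · intro s hs L
    -- Both limits exist and are multiples of the same `μ`, so the equivalence reduces to uniqueness
    -- of limits and `c ≠ 0`.
    obtain ⟨μ, hμ⟩ := exists_hasMean_cube (4 / 27 * (s ^ 2)⁻¹)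
    have h1 := hasProfile_three_of_hasMean hμ
    have h2 := hasProfile_three_halves_of_hasMean hs hμ
    have hΓ : (Real.Gamma (4 / 3) : ℂ) ≠ 0 :=
      Complex.ofReal_ne_zero.mpr (Real.Gamma_pos_of_pos (by norm_num)).ne'
    set c := ((Real.pi : ℂ) * (s : ℂ) / (3 * Complex.I)) ^ (1 / 2 : ℂ) with hc
    have hc0 : c ≠ 0 := by
      rw [hc, Ne, Complex.cpow_eq_zero_iff]
      simp [Real.pi_ne_zero, hs]
    constructor
    · intro h
      rw [h.unique h1]
      convert h2 using 1
      field_simp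
    · intro h
      have h3 := h.unique h2
      have h4 : L = μ * (Real.Gamma (4 / 3) : ℂ) := by
        field_simp at h3
        linear_combination h3
      rw [h4]
      exact h1
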